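/- Let $(M,g)$ be a smooth Riemannian manifold, let $(N,h,J)$ be an almost Hermitian manifold (that is, $(N,h)$ is a smooth Riemannian manifold and $J$ is a smooth field of $h$-orthogonal endomorphisms of the tangent spaces of $N$ with $J^2=-\mathrm{Id}$), and let $\varphi:M\to N$ be a smooth submersion. Put $\mathcal V=\ker\varphi_*$ and $\mathcal H=\mathcal V^\perp$, and denote by $\mathcal H$ also the orthogonal projection onto $\mathcal H$. Suppose that $\varphi$ is horizontally holomorphic, that is, $\mathcal H$ carries an almost Hermitian structure, also denoted $J$ (for each $x\in M$, an endomorphism $J_x$ of $\mathcal H_x$ which is orthogonal with respect to $g|_{\mathcal H_x}$ and satisfies $J_x^2=-\mathrm{Id}$), such that $\varphi_{*,x}(J_xv)=J_{\varphi(x)}(\varphi_{*,x}v)$ for all $x\in M$ and $v\in\mathcal H_x$. Then $$J(\operatorname{trace}B^{\mathcal V})+J(\tau(\varphi))+\operatorname{trace}_g\varphi^*(\nabla^NJ)-\operatorname{div}_{\mathcal H}J=0,$$ an equality of sections of $\varphi^*(TN)$, where $\mathcal H$ is identified with $\varphi^*(TN)$ by $\varphi_*$. Here $\nabla^M$ and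 $\nabla^N$ are the Levi-Civita connections of $(M,g)$ and $(N,h)$; - $B^{\mathcal V}(V,W)=\mathcal H(\nabla^M_VW)$, for $V,W$ vertical, is the second fundamental form of $\mathcal V$, i.e. of the fibres, and $\operatorname{trace}B^{\mathcal V}$ is its trace over an orthonormal basis of $\mathcal V_x$; - $\tau(\varphi)=\operatorname{trace}_g(\nabla\varphi_*)$ is the tension field, where $(\nabla\varphi_*)(X,Y)=(\varphi^*\nabla^N)_X(\varphi_*Y)-\varphi_*(\nabla^M_XY)$ for vector fields $X,Y$ on $M$; - $\operatorname{trace}_g\varphi^*(\nabla^NJ)$ is the trace with respect to $g$ of the bilinear form $(X,Y)\mapsto(\nabla^N_{\varphi_*X}J)(\varphi_*Y)$; - $\operatorname{div}_{\mathcal H}J=\sum_a\bigl((\mathcal H\nabla^M)_{X_a}J\bigr)(X_a)$ is the horizontal divergence of the structure $J$ on $\mathcal H$, where $(X_a)$ is a local orthonormal frame of $\mathcal H$ and $\bigl((\mathcal H\nabla^M)_XJ\bigr)(Y)=\mathcal H(\nabla^M_X(JY))-J(\mathcal H(\nabla^M_XY))$ for horizontal $X,Y$. -/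

import Mathlib

open Bundle Manifold
open scoped ContDiff

noncomputable section

namespace HorHol

section LeviCivita

variable {E : Type*} [NormedAddCommGroup E] [NormedSpace ℝ E] [FiniteDimensional ℝ E]
  {H : Type*} [TopologicalSpace H] {I : ModelWithCorners ℝ E H}
  {M : Type*} [TopologicalSpace M] [ChartedSpace H M]

/-- Tangent spaces are finite-dimensional, also with the norm that a metric gives them. -/
instance finiteDimensional_tangentSpace (x : M) : FiniteDimensional ℝ (TangentSpace I x) :=
  inferInstanceAs (FiniteDimensional ℝ E)

variable [RiemannianBundle (fun x : M ↦ TangentSpace I x)]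

/-- The right-hand side of the Koszul formula, which is `g(∇_X Y, Z)` at `x`. -/
def koszul (Y X Z : Π x : M, TangentSpace I x) (x : M) : ℝ :=
  (1 / 2) * (
    mvfderiv I (fun y ↦ inner ℝ (Y y) (Z y)) x (X x)
    + mvfderiv I (fun y ↦ inner ℝ (X y) (Z y)) x (Y x)
    - mvfderiv I (fun y ↦ inner ℝ (X y) (Y y)) x (Z x)
    + inner ℝ (VectorField.mlieBracket I X Y x) (Z x)
    - inner ℝ (VectorField.mlieBracket I X Z x) (Y x)
    - inner ℝ (VectorField.mlieBracket I Y Z x) (X x))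

variable [IsManifold I ∞ M] [IsContMDiffRiemannianBundle I ∞ E (fun x : M ↦ TangentSpace I x)]

theorem mdifferentiableAt_inner {X Y : Π x : M, TangentSpace I x} {x : M}
    (hX : MDiffAt (T% X) x) (hY : MDiffAt (T% Y) x) :
    MDiffAt (fun y ↦ inner ℝ (X y) (Y y)) x :=
  MDifferentiableAt.inner_bundle (E := fun x : M ↦ TangentSpace I x) (IB := I) (F := E) hX hY

theorem koszul_tensorialAt_right {Y X : Π x : M, TangentSpace I x} {x : M}
    (hY : MDiffAt (T% Y) x) (hX : MDiffAt (T% X) x) :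
    TensorialAt I E (fun Z ↦ koszul Y X Z x) x where
  smul {f Z} hf hZ := by
    simp only [koszul]
    simp [inner_smul_left, inner_smul_right, mvfderiv_fun_mul hf (mdifferentiableAt_inner hY hZ), mvfderiv_fun_mul hf (mdifferentiableAt_inner hX hZ), VectorField.mlieBracket_smul_right hf hZ, inner_add_left, real_inner_comm]
    ring
  add {Z Z'} hZ hZ' := by
    simp only [koszul]
    simp [inner_add_left, inner_add_right, mvfderiv_fun_add (mdifferentiableAt_inner hY hZ) (mdifferentiableAt_inner hY hZ'), mvfderiv_fun_add (mdifferentiableAt_inner hX hZ) (mdifferentiableAt_inner hX hZ'), VectorField.mlieBracket_add_right hZ hZ']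
    ring

theorem koszul_tensorialAt_left {Y Z : Π x : M, TangentSpace I x} {x : M}
    (hY : MDiffAt (T% Y) x) (hZ : MDiffAt (T% Z) x) :
    TensorialAt I E (fun X ↦ koszul Y X Z x) x where
  smul {f X} hf hX := by
    simp only [koszul]
    simp [inner_smul_left, inner_smul_right, mvfderiv_fun_mul hf (mdifferentiableAt_inner hZ hX), mvfderiv_fun_mul hf (mdifferentiableAt_inner hY hX), VectorField.mlieBracket_smul_left hf hX, inner_add_left, real_inner_comm]
    ring
  add {X X'} hX hX' := by
    simp only [koszul]
    simp [inner_add_left, inner_add_right, mvfderiv_fun_add (mdifferentiableAt_inner hX hZ) (mdifferentiableAt_inner hX' hZ), mvfderiv_fun_add (mdifferentiableAt_inner hX hY) (mdifferentiableAt_inner hX' hY), VectorField.mlieBracket_add_left hX hX']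
    ring

/-- The vector `A v` with `g(A v, w) = B v w` for all `w`. -/
def raise {x : M} (B : TangentSpace I x →L[ℝ] TangentSpace I x →L[ℝ] ℝ) :
    TangentSpace I x →L[ℝ] TangentSpace I x :=
  LinearMap.toContinuousLinearMap (𝕜 := ℝ)
    { toFun := fun v ↦ (InnerProductSpace.toDual ℝ (TangentSpace I x)).symm (B v)
      map_add' := by simp
      map_smul' := by simp }

open Classical in
/-- `∇_X Y` at `x` as a continuous linear function of `X x`: the vector representing the
linear form `Z ↦ koszul Y X Z x`.  Junk value `0` where `Y` is not differentiable. -/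
def leviCivitaFun (Y : Π x : M, TangentSpace I x) (x : M) :
    TangentSpace I x →L[ℝ] TangentSpace I x :=
  if hY : MDiffAt (T% Y) x then
    raise (TensorialAt.mkHom₂ (fun X Z ↦ koszul Y X Z x) x
      (fun _ hZ ↦ koszul_tensorialAt_left hY hZ) (fun _ hX ↦ koszul_tensorialAt_right hY hX))
  else 0

theorem inner_leviCivitaFun {Y X Z : Π x : M, TangentSpace I x} {x : M}
    (hY : MDiffAt (T% Y) x) (hX : MDiffAt (T% X) x) (hZ : MDiffAt (T% Z) x) :
    inner ℝ (leviCivitaFun Y x (X x)) (Z x) = koszul Y X Z x := by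
  rw [leviCivitaFun, dif_pos hY]
  have h : ∀ (B : TangentSpace I x →L[ℝ] TangentSpace I x →L[ℝ] ℝ) (v w : TangentSpace I x),
      inner ℝ (raise B v) w = B v w := fun B v w ↦ by simp [raise]
  rw [h]
  exact TensorialAt.mkHom₂_apply (Φ := fun X Z ↦ koszul Y X Z x)
    (fun _ hZ ↦ koszul_tensorialAt_left hY hZ) (fun _ hX ↦ koszul_tensorialAt_right hY hX) hX hZ

theorem leviCivitaFun_eq {x : M} {Y : Π x : M, TangentSpace I x} (hY : MDiffAt (T% Y) x)
    (A : TangentSpace I x →L[ℝ] TangentSpace I x)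
   (hA : ∀ X Z : Π x : M, TangentSpace I x, MDiffAt (T% X) x → MDiffAt (T% Z) x →
     koszul Y X Z x = inner ℝ (A (X x)) (Z x)) : leviCivitaFun Y x = A := by
  ext X₀
  refine ext_inner_right ℝ fun Z₀ ↦ ?_
  have hX := FiberBundle.mdifferentiableAt_extend I E X₀
  have hZ := FiberBundle.mdifferentiableAt_extend I E Z₀
  have h := hA _ _ hX hZ
  rw [← inner_leviCivitaFun hY hX hZ] at h
  simpa using h

variable (I M) in
/-- The Levi-Civita connection of a Riemannian manifold, given by the Koszul formula. -/
def leviCivita : CovariantDerivative I E (TangentSpace I : M → Type _) where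
  toFun := leviCivitaFun
  isCovariantDerivativeOnUniv :=
    { add := by
        intro Y Y' x hY hY' _
        refine leviCivitaFun_eq (mdifferentiableAt_add_section hY hY') _ fun X Z hX hZ ↦ ?_
        simp only [add_apply, inner_add_left,
          inner_leviCivitaFun hY hX hZ, inner_leviCivitaFun hY' hX hZ]
        simp [koszul, inner_add_left, inner_add_right, mvfderiv_fun_add (mdifferentiableAt_inner hY hZ) (mdifferentiableAt_inner hY' hZ), mvfderiv_fun_add (mdifferentiableAt_inner hX hY) (mdifferentiableAt_inner hX hY'), VectorField.mlieBracket_add_right hY hY', VectorField.mlieBracket_add_left hY hY']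
        ring
      leibniz := by
        intro Y f x hY hf _
        refine leviCivitaFun_eq (hf.smul_section hY) _ fun X Z hX hZ ↦ ?_
        simp [inner_add_left, inner_smul_left, inner_leviCivitaFun hY hX hZ]
        simp [koszul, inner_smul_left, inner_smul_right, mvfderiv_fun_mul hf (mdifferentiableAt_inner hY hZ), mvfderiv_fun_mul hf (mdifferentiableAt_inner hY hX), VectorField.mlieBracket_smul_right hf hY, VectorField.mlieBracket_smul_left hf hY, inner_add_left, real_inner_comm]
        ring }

theorem leviCivita_isMetricCompatible : 
    CovariantDerivative.IsMetricCompatible (V := fun x : M ↦ TangentSpace I x) (leviCivita I M) := by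
  rw [CovariantDerivative.isMetricCompatible_iff]
  intro x X Y Z hX hY hZ
  have h1 := inner_leviCivitaFun hY hX hZ
  have h2 := inner_leviCivitaFun hZ hX hY
  simp only [leviCivita]
  rw [real_inner_comm] at h2
  rw [h1, h2]
  have e1 : (fun y ↦ inner ℝ (Z y) (Y y)) = fun y ↦ inner ℝ (Y y) (Z y) := by
    ext y; exact real_inner_comm _ _
  simp only [koszul, VectorField.mlieBracket_swap_apply (V := Z) (W := Y), inner_neg_left, e1]
  ring

theorem leviCivita_torsion : (leviCivita I M).torsion = 0 := by
  rw [CovariantDerivative.torsion_eq_zero_iff]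
  intro X Y x hX hY
  refine ext_inner_right ℝ fun Z₀ ↦ ?_
  have hZ := FiberBundle.mdifferentiableAt_extend I E Z₀
  have h1 := inner_leviCivitaFun hY hX hZ
  have h2 := inner_leviCivitaFun hX hY hZ
  simp only [FiberBundle.extend_apply_self] at h1 h2
  simp only [leviCivita]
  rw [inner_sub_left, h1, h2]
  have e1 : (fun y ↦ inner ℝ (Y y) (X y)) = fun y ↦ inner ℝ (X y) (Y y) := by
    ext y; exact real_inner_comm _ _
  simp only [koszul, FiberBundle.extend_apply_self,
    VectorField.mlieBracket_swap_apply (V := Y) (W := X), inner_neg_left, e1]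
  ring

end LeviCivita

section Maps

variable {E : Type*} [NormedAddCommGroup E] [NormedSpace ℝ E] [FiniteDimensional ℝ E]
  {H : Type*} [TopologicalSpace H] (I : ModelWithCorners ℝ E H)
  {M : Type*} [TopologicalSpace M] [ChartedSpace H M] [IsManifold I ∞ M]
  [RiemannianBundle (fun x : M ↦ TangentSpace I x)]
  [IsContMDiffRiemannianBundle I ∞ E (fun x : M ↦ TangentSpace I x)]
  {E' : Type*} [NormedAddCommGroup E'] [NormedSpace ℝ E'] [FiniteDimensional ℝ E']
  {H' : Type*} [TopologicalSpace H'] (I' : ModelWithCorners ℝ E' H')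
  {N : Type*} [TopologicalSpace N] [ChartedSpace H' N] [IsManifold I' ∞ N]
  [RiemannianBundle (fun y : N ↦ TangentSpace I' y)]
  [IsContMDiffRiemannianBundle I' ∞ E' (fun y : N ↦ TangentSpace I' y)]

/-- A smooth submersion: a smooth map whose differential is onto at every point. -/
structure IsSmoothSubmersion (φ : M → N) : Prop where
  contMDiff : ContMDiff I I' ∞ φ
  surjective (x : M) : Function.Surjective (mfderiv I I' φ x)

/-- An almost Hermitian structure on a Riemannian manifold: a smooth field `J` of orthogonal
endomorphisms of the tangent spaces with `J² = -1`. -/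
structure IsAlmostHermitian (J : Π y : N, TangentSpace I' y →L[ℝ] TangentSpace I' y) : Prop where
  contMDiff : ContMDiff I' (I'.prod 𝓘(ℝ, E' →L[ℝ] E')) ∞
    (fun y ↦ TotalSpace.mk' (E' →L[ℝ] E')
      (E := fun y : N ↦ TangentSpace I' y →L[ℝ] TangentSpace I' y) y (J y))
  sq (y : N) (v : TangentSpace I' y) : J y (J y v) = -v
  inner_map (y : N) (v w : TangentSpace I' y) : inner ℝ (J y v) (J y w) = inner ℝ v w

/-- The vertical space `𝒱ₓ = ker φ_{*,x}`. -/
abbrev vertical (φ : M → N) (x : M) : Submodule ℝ (TangentSpace I x) :=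
  LinearMap.ker (mfderiv I I' φ x).toLinearMap

/-- The horizontal space `ℋₓ`, the orthogonal complement of the vertical space. -/
abbrev horizontal (φ : M → N) (x : M) : Submodule ℝ (TangentSpace I x) :=
  (vertical I I' φ x)ᗮ

/-- The orthogonal projection `TₓM → ℋₓ`. -/
abbrev horizontalProj (φ : M → N) (x : M) : TangentSpace I x →L[ℝ] horizontal I I' φ x :=
  (horizontal I I' φ x).orthogonalProjectionOnto

/-- The orthogonal projection `TₓM → 𝒱ₓ`. -/
abbrev verticalProj (φ : M → N) (x : M) : TangentSpace I x →L[ℝ] vertical I I' φ x :=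
  (vertical I I' φ x).orthogonalProjectionOnto

/-- `φ` is horizontally holomorphic with respect to the almost complex structure `J` on the
codomain and the field `JH` of endomorphisms of the horizontal spaces: `JH` is an almost Hermitian
structure on the horizontal distribution (with the induced metric), and the restriction of the
differential of `φ` to each horizontal space is complex linear. -/
structure IsHorizontallyHolomorphic (φ : M → N)
    (J : Π y : N, TangentSpace I' y →L[ℝ] TangentSpace I' y)
    (JH : Π x : M, horizontal I I' φ x →ₗ[ℝ] horizontal I I' φ x) : Prop where
  sq (x : M) (v : horizontal I I' φ x) : JH x (JH x v) = -v
  inner_map (x : M) (v w : horizontal I I' φ x) : inner ℝ (JH x v) (JH x w) = inner ℝ v w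
  map_eq (x : M) (v : horizontal I I' φ x) :
    mfderiv I I' φ x (JH x v : TangentSpace I x) =
      J (φ x) (mfderiv I I' φ x (v : TangentSpace I x))

/-- The trace of a bilinear map on a finite-dimensional Euclidean space, by an orthonormal basis
(for a bilinear map the choice of the basis does not matter). -/
def metricTrace {V W : Type*} [NormedAddCommGroup V] [InnerProductSpace ℝ V]
    [FiniteDimensional ℝ V] [AddCommGroup W] (b : V → V → W) : W :=
  ∑ i, b (stdOrthonormalBasis ℝ V i) (stdOrthonormalBasis ℝ V i)

/-- The second fundamental form `(V, W) ↦ ℋ(∇_V W)` of the vertical distribution (so of the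
fibres); `W` is extended to a vertical field near `x`. -/
def verticalSecondFundamentalForm (φ : M → N) (x : M) (V W : vertical I I' φ x) :
    horizontal I I' φ x :=
  horizontalProj I I' φ x
    (leviCivita I M
      (fun y ↦ (verticalProj I I' φ y (FiberBundle.extend E (W : TangentSpace I x) y) :
        TangentSpace I y)) x (V : TangentSpace I x))

/-- The pull-back by `φ` of a connection on the tangent bundle of `N`, applied to a section `σ` of
`φ^*(TN)` and a vector `v` at `x`.  In the trivialization of `TN` around `φ x`, differentiate the
components of `σ` along `v`, and add the derivative along `φ_* v` of the field with constant
components that extends `σ x`. -/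
def pullbackCovariantDerivative (cov : CovariantDerivative I' E' (TangentSpace I' : N → Type _))
    (φ : M → N) (σ : Π y : M, TangentSpace I' (φ y)) (x : M) (v : TangentSpace I x) :
    TangentSpace I' (φ x) :=
  (trivializationAt E' (TangentSpace I' : N → Type _) (φ x)).symmL ℝ (φ x)
    (mvfderiv I (fun y ↦
      ((trivializationAt E' (TangentSpace I' : N → Type _) (φ x)) ⟨φ y, σ y⟩).2) x v)
  + cov (FiberBundle.extend E' (σ x)) (φ x) (mfderiv I I' φ x v)

/-- The second fundamental form `∇φ_*` of a map between Riemannian manifolds,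
`(∇φ_*)(v, w) = (φ^*∇ᴺ)_v (φ_* w) - φ_* (∇ᴹ_v w)`; `w` is extended to a field near `x`. -/
def mapSecondFundamentalForm (φ : M → N) (x : M) (v w : TangentSpace I x) :
    TangentSpace I' (φ x) :=
  pullbackCovariantDerivative I I' (leviCivita I' N) φ
      (fun y ↦ mfderiv I I' φ y (FiberBundle.extend E w y)) x v
    - mfderiv I I' φ x (leviCivita I M (FiberBundle.extend E w) x v)

/-- The tension field `τ(φ)`, the trace of `∇φ_*`. -/
def tensionField (φ : M → N) (x : M) : TangentSpace I' (φ x) :=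
  metricTrace (mapSecondFundamentalForm I I' φ x)

/-- The covariant derivative `(∇_Z J)(W) = ∇_Z (J W) - J (∇_Z W)` of a field of endomorphisms of
the tangent spaces; `W` is extended to a field near `y`. -/
def nablaEnd (J : Π y : N, TangentSpace I' y →L[ℝ] TangentSpace I' y) (y : N)
    (Z W : TangentSpace I' y) : TangentSpace I' y :=
  leviCivita I' N (fun z ↦ J z (FiberBundle.extend E' W z)) y Z
    - J y (leviCivita I' N (FiberBundle.extend E' W) y Z)

/-- The trace `trace_g φ^*(∇ᴺJ)` of the bilinear form `(v, w) ↦ (∇ᴺ_{φ_* v} J)(φ_* w)`. -/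
def tracePullbackNabla (φ : M → N) (J : Π y : N, TangentSpace I' y →L[ℝ] TangentSpace I' y)
    (x : M) : TangentSpace I' (φ x) :=
  metricTrace (fun v w : TangentSpace I x ↦
    nablaEnd I' J (φ x) (mfderiv I I' φ x v) (mfderiv I I' φ x w))

/-- The covariant derivative of a field `T` of endomorphisms of the horizontal spaces with respect
to the connection `ℋ∇` induced on the horizontal distribution,
`((ℋ∇)_v T)(w) = ℋ(∇_v (T w)) - T(ℋ(∇_v w))`; `w` is extended to a horizontal field near `x`. -/
def horizontalNabla (φ : M → N) (T : Π x : M, horizontal I I' φ x →ₗ[ℝ] horizontal I I' φ x)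
    (x : M) (v w : horizontal I I' φ x) : horizontal I I' φ x :=
  horizontalProj I I' φ x
      (leviCivita I M
        (fun y ↦ (T y (horizontalProj I I' φ y
          (FiberBundle.extend E (w : TangentSpace I x) y)) : TangentSpace I y)) x
        (v : TangentSpace I x))
    - T x (horizontalProj I I' φ x
      (leviCivita I M
        (fun y ↦ (horizontalProj I I' φ y
          (FiberBundle.extend E (w : TangentSpace I x) y) : TangentSpace I y)) x
        (v : TangentSpace I x)))

/-- The horizontal divergence `div_ℋ T = ∑ₐ ((ℋ∇)_{Xₐ} T)(Xₐ)` of a field of endomorphisms of the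
horizontal spaces, with `(Xₐ)` an orthonormal basis of the horizontal space. -/
def horizontalDivergence (φ : M → N)
    (T : Π x : M, horizontal I I' φ x →ₗ[ℝ] horizontal I I' φ x) (x : M) :
    horizontal I I' φ x :=
  metricTrace (horizontalNabla I I' φ T x)

end Maps

end HorHol

end

open HorHol

noncomputable section

namespace HorHol

open Filter
open scoped Topology

section CoordinateDerivative

variable {EM : Type*} [NormedAddCommGroup EM] [NormedSpace ℝ EM]
  {HM : Type*} [TopologicalSpace HM] {IM : ModelWithCorners ℝ EM HM}
  {M : Type*} [TopologicalSpace M] [ChartedSpace HM M]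
  {EB : Type*} [NormedAddCommGroup EB] [NormedSpace ℝ EB]
  {HB : Type*} [TopologicalSpace HB] {IB : ModelWithCorners ℝ EB HB}
  {B : Type*} [TopologicalSpace B] [ChartedSpace HB B]
  {EB' : Type*} [NormedAddCommGroup EB'] [NormedSpace ℝ EB']
  {HB' : Type*} [TopologicalSpace HB'] {IB' : ModelWithCorners ℝ EB' HB'}
  {B' : Type*} [TopologicalSpace B'] [ChartedSpace HB' B']
  {F : Type*} [NormedAddCommGroup F] [NormedSpace ℝ F]
  {V : B → Type*} [TopologicalSpace (TotalSpace F V)]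
  [∀ b, AddCommGroup (V b)] [∀ b, Module ℝ (V b)] [∀ b, TopologicalSpace (V b)]
  [FiberBundle F V] [VectorBundle ℝ F V]
  {F' : Type*} [NormedAddCommGroup F'] [NormedSpace ℝ F']
  {V' : B' → Type*} [TopologicalSpace (TotalSpace F' V')]
  [∀ b, AddCommGroup (V' b)] [∀ b, Module ℝ (V' b)] [∀ b, TopologicalSpace (V' b)]
  [FiberBundle F' V'] [VectorBundle ℝ F' V']

variable (IM F) in
/-- The derivative at `x` of a section `s` of `V` along `b`, read in the trivialization of `V`
around `b x`. -/
def coordDeriv (b : M → B) (s : Π m : M, V (b m)) (x : M) : TangentSpace IM x →L[ℝ] F :=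
  mvfderiv IM (fun y ↦ (trivializationAt F V (b x) ⟨b y, s y⟩).2) x

omit [NormedSpace ℝ F] [∀ b, Module ℝ (V b)] [VectorBundle ℝ F V] [∀ b, AddCommGroup (V b)] in
theorem eventually_mem_baseSet {b : M → B} {x : M} (hb : ContinuousAt b x) :
    ∀ᶠ y in 𝓝 x, b y ∈ (trivializationAt F V (b x)).baseSet :=
  hb.eventually ((trivializationAt F V (b x)).open_baseSet.mem_nhds
    (FiberBundle.mem_baseSet_trivializationAt' (b x)))

omit [∀ b, Module ℝ (V b)] [VectorBundle ℝ F V] in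
theorem mvfderiv_congr_of_eventuallyEq {f f' : M → F} {x : M} (h : f =ᶠ[𝓝 x] f') :
    mvfderiv IM f x = mvfderiv IM f' x := by
  unfold mvfderiv
  rw [h.mfderiv_eq, h.self_of_nhds]

theorem mvfderiv_clm_apply {f : M → F →L[ℝ] F'} {g : M → F} {x : M}
    (hf : MDifferentiableAt IM 𝓘(ℝ, F →L[ℝ] F') f x) (hg : MDifferentiableAt IM 𝓘(ℝ, F) g x)
    (v : TangentSpace IM x) :
    mvfderiv IM (fun y ↦ f y (g y)) x v = f x (mvfderiv IM g x v) + mvfderiv IM f x v (g x) := by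
  let dg : EM →L[ℝ] F := mvfderiv IM g x
  let df : EM →L[ℝ] F →L[ℝ] F' := mvfderiv IM f x
  have h : HasMFDerivAt IM 𝓘(ℝ, F') (fun y ↦ f y (g y)) x
      ((f x).comp dg + df.flip (g x) : EM →L[ℝ] F') := by
    refine ⟨hf.continuousAt.clm_apply hg.continuousAt, ?_⟩
    have h1 := hf.hasMFDerivAt.2.clm_apply hg.hasMFDerivAt.2
    simpa [writtenInExtChartAt, Function.comp_def] using! h1
  exact congrArg (fun L : EM →L[ℝ] F' ↦ L v) h.mfderiv

omit [∀ b, Module ℝ (V b)] [VectorBundle ℝ F V] [∀ b, AddCommGroup (V b)] in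
theorem coordDeriv_of_eventually_const {b : M → B} {s : Π m : M, V (b m)} {x : M} (w : F)
    (h : ∀ᶠ y in 𝓝 x, (trivializationAt F V (b x) ⟨b y, s y⟩).2 = w) :
    coordDeriv IM F b s x = 0 := by
  rw [coordDeriv, mvfderiv_congr_of_eventuallyEq (f' := fun _ ↦ w) h, mvfderiv_const]

omit [NormedSpace ℝ F] [∀ b, Module ℝ (V b)] [VectorBundle ℝ F V] in
theorem trivializationAt_extend {b₀ b : B} (v : V b₀)
    (hb : b ∈ (trivializationAt F V b₀).baseSet) :
    (trivializationAt F V b₀ ⟨b, FiberBundle.extend F v b⟩).2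
      = (trivializationAt F V b₀ ⟨b₀, v⟩).2 := by
  simp [FiberBundle.extend, (trivializationAt F V b₀).apply_mk_symm hb]

omit [∀ b, Module ℝ (V b)] [VectorBundle ℝ F V] in
theorem coordDeriv_extend_comp {b : M → B} {x : M} (hb : ContinuousAt b x) (v : V (b x)) :
    coordDeriv IM F b (fun y ↦ FiberBundle.extend F v (b y)) x = 0 :=
  coordDeriv_of_eventually_const _ <| by
    filter_upwards [eventually_mem_baseSet (F := F) (V := V) hb] with y hy
    exact trivializationAt_extend v hy

omit [∀ b, Module ℝ (V b)] [VectorBundle ℝ F V] in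
theorem coordDeriv_extend {x : B} (v : V x) :
    coordDeriv IB F id (FiberBundle.extend F v) x = 0 :=
  coordDeriv_extend_comp continuousAt_id v

theorem coordDeriv_add {b : M → B} {s s' : Π m : M, V (b m)} {x : M}
    (hs : MDifferentiableAt IM (IB.prod 𝓘(ℝ, F)) (fun m ↦ TotalSpace.mk' F (b m) (s m)) x)
    (hs' : MDifferentiableAt IM (IB.prod 𝓘(ℝ, F)) (fun m ↦ TotalSpace.mk' F (b m) (s' m)) x) :
    coordDeriv IM F b (fun y ↦ s y + s' y) x
      = coordDeriv IM F b s x + coordDeriv IM F b s' x := by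
  rw [mdifferentiableAt_totalSpace] at hs hs'
  have h : (fun y ↦ (trivializationAt F V (b x) ⟨b y, s y + s' y⟩).2) =ᶠ[𝓝 x]
      (fun y ↦ (trivializationAt F V (b x) ⟨b y, s y⟩).2)
        + fun y ↦ (trivializationAt F V (b x) ⟨b y, s' y⟩).2 := by
    filter_upwards [eventually_mem_baseSet (F := F) (V := V) hs.1.continuousAt] with y hy
    exact ((trivializationAt F V (b x)).linear ℝ hy).map_add _ _
  rw [coordDeriv, mvfderiv_congr_of_eventuallyEq h, mvfderiv_add hs.2 hs'.2]
  rfl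

theorem coordDeriv_smul {b : M → B} {f : M → ℝ} {s : Π m : M, V (b m)} {x : M}
    (hf : MDifferentiableAt IM 𝓘(ℝ, ℝ) f x)
    (hs : MDifferentiableAt IM (IB.prod 𝓘(ℝ, F)) (fun m ↦ TotalSpace.mk' F (b m) (s m)) x) :
    coordDeriv IM F b (fun y ↦ f y • s y) x
      = f x • coordDeriv IM F b s x
        + (mvfderiv IM f x).smulRight (trivializationAt F V (b x) ⟨b x, s x⟩).2 := by
  rw [mdifferentiableAt_totalSpace] at hs
  have h : (fun y ↦ (trivializationAt F V (b x) ⟨b y, f y • s y⟩).2) =ᶠ[𝓝 x]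
      f • (fun y ↦ (trivializationAt F V (b x) ⟨b y, s y⟩).2) := by
    filter_upwards [eventually_mem_baseSet (F := F) (V := V) hs.1.continuousAt] with y hy
    exact ((trivializationAt F V (b x)).linear ℝ hy).map_smul _ _
  rw [coordDeriv, mvfderiv_congr_of_eventuallyEq h, mvfderiv_smul hf hs.2]
  rfl

/-- The difference of the derivatives of two sections with the same value at `x` is mapped by a
family of linear maps without a derivative of the latter. -/
theorem coordDeriv_clm_apply_sub {b : M → B} {b' : M → B'} {x : M}
    {A : Π m : M, V (b m) →L[ℝ] V' (b' m)} {s s' : Π m : M, V (b m)}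
    (hA : MDifferentiableAt IM 𝓘(ℝ, F →L[ℝ] F') (fun m ↦
      ContinuousLinearMap.inCoordinates F V F' V' (b x) (b m) (b' x) (b' m) (A m)) x)
    (hs : MDifferentiableAt IM (IB.prod 𝓘(ℝ, F)) (fun m ↦ TotalSpace.mk' F (b m) (s m)) x)
    (hs' : MDifferentiableAt IM (IB.prod 𝓘(ℝ, F)) (fun m ↦ TotalSpace.mk' F (b m) (s' m)) x)
    (hb' : ContinuousAt b' x) (hss' : s x = s' x) (v : TangentSpace IM x) :
    (trivializationAt F' V' (b' x)).symmL ℝ (b' x)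
        (coordDeriv IM F' b' (fun m ↦ A m (s m)) x v)
      - (trivializationAt F' V' (b' x)).symmL ℝ (b' x)
        (coordDeriv IM F' b' (fun m ↦ A m (s' m)) x v)
      = A x ((trivializationAt F V (b x)).symmL ℝ (b x) (coordDeriv IM F b s x v)
        - (trivializationAt F V (b x)).symmL ℝ (b x) (coordDeriv IM F b s' x v)) := by
  have key : ∀ {t : Π m : M, V (b m)},
      MDifferentiableAt IM (IB.prod 𝓘(ℝ, F)) (fun m ↦ TotalSpace.mk' F (b m) (t m)) x →
      coordDeriv IM F' b' (fun m ↦ A m (t m)) x v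
        = ContinuousLinearMap.inCoordinates F V F' V' (b x) (b x) (b' x) (b' x) (A x)
            (coordDeriv IM F b t x v)
          + mvfderiv IM (fun m ↦ ContinuousLinearMap.inCoordinates F V F' V'
            (b x) (b m) (b' x) (b' m) (A m)) x v (trivializationAt F V (b x) ⟨b x, t x⟩).2 := by
    intro t ht
    have ht' := (mdifferentiableAt_totalSpace _ _).1 ht
    rw [coordDeriv, mvfderiv_congr_of_eventuallyEq (f' := fun m ↦
      ContinuousLinearMap.inCoordinates F V F' V' (b x) (b m) (b' x) (b' m) (A m)
        (trivializationAt F V (b x) ⟨b m, t m⟩).2), mvfderiv_clm_apply hA ht'.2]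
    · rfl
    · filter_upwards [eventually_mem_baseSet (F := F) (V := V) ht'.1.continuousAt,
        eventually_mem_baseSet (F := F') (V := V') hb'] with m hm hm'
      rw [ContinuousLinearMap.inCoordinates_eq hm hm']
      simp [hm]
  have hb := FiberBundle.mem_baseSet_trivializationAt' (F := F) (E := V) (b x)
  have hb'' := FiberBundle.mem_baseSet_trivializationAt' (F := F') (E := V') (b' x)
  rw [key hs, key hs', hss', ← map_sub, add_sub_add_right_eq_sub, ← map_sub, ← map_sub,
    ContinuousLinearMap.inCoordinates_eq hb hb'']
  simp [hb, hb'', -map_sub]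

end CoordinateDerivative

section Connections

variable {E : Type*} [NormedAddCommGroup E] [NormedSpace ℝ E] [FiniteDimensional ℝ E]
  {H : Type*} [TopologicalSpace H] {I : ModelWithCorners ℝ E H}
  {M : Type*} [TopologicalSpace M] [ChartedSpace H M] [IsManifold I ∞ M]
  {E' : Type*} [NormedAddCommGroup E'] [NormedSpace ℝ E'] [FiniteDimensional ℝ E']
  {H' : Type*} [TopologicalSpace H'] {I' : ModelWithCorners ℝ E' H'}
  {N : Type*} [TopologicalSpace N] [ChartedSpace H' N] [IsManifold I' ∞ N]

omit [FiniteDimensional ℝ E] in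
theorem covariantDerivative_sub_coordDeriv_tensorialAt
    (cov : CovariantDerivative I E (TangentSpace I : M → Type _)) (x : M) (v : TangentSpace I x) :
    TensorialAt I E (fun σ : Π y : M, TangentSpace I y ↦ cov σ x v
      - (trivializationAt E (TangentSpace I : M → Type _) x).symmL ℝ x
        (coordDeriv I E id σ x v)) x where
  smul {f σ} hf hσ := by
    have h1 := cov.isCovariantDerivativeOnUniv.leibniz hσ hf
    have h2 := coordDeriv_smul (b := id) hf hσ
    simp only [Pi.smul_def'] at h1 ⊢
    simp only [id] at h1 h2 ⊢
    rw [h1, h2]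
    have h3 := (trivializationAt E (TangentSpace I : M → Type _) x).symm_apply_apply_mk
      (FiberBundle.mem_baseSet_trivializationAt' x) (σ x)
    rw [← Trivialization.symmL_apply (R := ℝ) _
      (FiberBundle.mem_baseSet_trivializationAt' x)] at h3
    simp [smul_sub, h3]
  add {σ σ'} hσ hσ' := by
    have h1 := cov.isCovariantDerivativeOnUniv.add hσ hσ'
    have h2 := coordDeriv_add (b := id) hσ hσ'
    simp only [Pi.add_def] at h1 ⊢
    simp only [id] at h1 h2 ⊢
    rw [h1, h2]
    simp
    abel

/-- A connection in coordinates: the derivative of the components plus the derivative of the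
field with constant components. -/
theorem covariantDerivative_eq_coordDeriv_add
    (cov : CovariantDerivative I E (TangentSpace I : M → Type _)) {x : M}
    {σ : Π y : M, TangentSpace I y} (hσ : MDiffAt (T% σ) x) (v : TangentSpace I x) :
    cov σ x v = (trivializationAt E (TangentSpace I : M → Type _) x).symmL ℝ x
        (coordDeriv I E id σ x v) + cov (FiberBundle.extend E (σ x)) x v := by
  have h := (covariantDerivative_sub_coordDeriv_tensorialAt cov x v).pointwise hσ
    (FiberBundle.mdifferentiableAt_extend I E (σ x)) (by simp)
  rw [coordDeriv_extend] at h
  simp only [_root_.map_zero, zero_apply, sub_zero] at h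
  rw [← h]
  abel

omit [FiniteDimensional ℝ E] [IsManifold I ∞ M] [FiniteDimensional ℝ E'] in
theorem pullbackCovariantDerivative_eq_coordDeriv_add
    (cov : CovariantDerivative I' E' (TangentSpace I' : N → Type _)) (φ : M → N)
    (σ : Π y : M, TangentSpace I' (φ y)) (x : M) (v : TangentSpace I x) :
    pullbackCovariantDerivative I I' cov φ σ x v
      = (trivializationAt E' (TangentSpace I' : N → Type _) (φ x)).symmL ℝ (φ x)
          (coordDeriv I E' φ σ x v)
        + cov (FiberBundle.extend E' (σ x)) (φ x) (mfderiv I I' φ x v) :=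
  rfl

omit [FiniteDimensional ℝ E] [IsManifold I ∞ M] in
theorem pullbackCovariantDerivative_comp
    (cov : CovariantDerivative I' E' (TangentSpace I' : N → Type _)) {φ : M → N} {x : M}
    (hφ : MDifferentiableAt I I' φ x) {τ : Π z : N, TangentSpace I' z}
    (hτ : MDiffAt (T% τ) (φ x)) (v : TangentSpace I x) :
    pullbackCovariantDerivative I I' cov φ (fun y ↦ τ (φ y)) x v
      = cov τ (φ x) (mfderiv I I' φ x v) := by
  rw [covariantDerivative_eq_coordDeriv_add cov hτ,
    pullbackCovariantDerivative_eq_coordDeriv_add]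
  congr 2
  have h := (mdifferentiableAt_totalSpace _ _).1 hτ
  exact mfderiv_comp_apply x h.2 hφ v

omit [FiniteDimensional ℝ E] [FiniteDimensional ℝ E'] in
/-- The rule for the derivative of `A σ`, with `A` a family of linear maps along `f`, reduced to
one section with the same value. -/
theorem pullbackCovariantDerivative_clm_apply_sub
    (cov : CovariantDerivative I E (TangentSpace I : M → Type _))
    {E'' : Type*} [NormedAddCommGroup E''] [NormedSpace ℝ E'']
    {H'' : Type*} [TopologicalSpace H''] {I'' : ModelWithCorners ℝ E'' H''}
    {P : Type*} [TopologicalSpace P] [ChartedSpace H'' P]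
    (cov' : CovariantDerivative I' E' (TangentSpace I' : N → Type _)) {b : P → M} {b' : P → N}
    {x : P} {A : Π m : P, TangentSpace I (b m) →L[ℝ] TangentSpace I' (b' m)}
    {s s' : Π m : P, TangentSpace I (b m)}
    (hA : MDifferentiableAt I'' 𝓘(ℝ, E →L[ℝ] E') (fun m ↦
      ContinuousLinearMap.inCoordinates E (TangentSpace I) E' (TangentSpace I')
        (b x) (b m) (b' x) (b' m) (A m)) x)
    (hs : MDifferentiableAt I'' (I.prod 𝓘(ℝ, E)) (fun m ↦ TotalSpace.mk' E (b m) (s m)) x)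
    (hs' : MDifferentiableAt I'' (I.prod 𝓘(ℝ, E)) (fun m ↦ TotalSpace.mk' E (b m) (s' m)) x)
    (hb' : ContinuousAt b' x) (hss' : s x = s' x) (v : TangentSpace I'' x) :
    pullbackCovariantDerivative I'' I' cov' b' (fun m ↦ A m (s m)) x v
      - pullbackCovariantDerivative I'' I' cov' b' (fun m ↦ A m (s' m)) x v
      = A x (pullbackCovariantDerivative I'' I cov b s x v
        - pullbackCovariantDerivative I'' I cov b s' x v) := by
  simp only [pullbackCovariantDerivative_eq_coordDeriv_add, hss']
  rw [add_sub_add_right_eq_sub, add_sub_add_right_eq_sub]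
  exact coordDeriv_clm_apply_sub hA hs hs' hb' hss' v

end Connections

section Maps

variable {E : Type*} [NormedAddCommGroup E] [NormedSpace ℝ E] [FiniteDimensional ℝ E]
  {H : Type*} [TopologicalSpace H] {I : ModelWithCorners ℝ E H}
  {M : Type*} [TopologicalSpace M] [ChartedSpace H M] [IsManifold I ∞ M]
  [RiemannianBundle (fun x : M ↦ TangentSpace I x)]
  [IsContMDiffRiemannianBundle I ∞ E (fun x : M ↦ TangentSpace I x)]
  {E' : Type*} [NormedAddCommGroup E'] [NormedSpace ℝ E'] [FiniteDimensional ℝ E']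
  {H' : Type*} [TopologicalSpace H'] {I' : ModelWithCorners ℝ E' H'}
  {N : Type*} [TopologicalSpace N] [ChartedSpace H' N] [IsManifold I' ∞ N]
  [RiemannianBundle (fun y : N ↦ TangentSpace I' y)]
  [IsContMDiffRiemannianBundle I' ∞ E' (fun y : N ↦ TangentSpace I' y)]

omit [FiniteDimensional ℝ E] [RiemannianBundle fun x : M ↦ TangentSpace I x]
  [IsContMDiffRiemannianBundle I ∞ E fun x : M ↦ TangentSpace I x] [FiniteDimensional ℝ E']
  [RiemannianBundle fun y : N ↦ TangentSpace I' y]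
  [IsContMDiffRiemannianBundle I' ∞ E' fun y : N ↦ TangentSpace I' y] in
theorem mdifferentiableAt_inCoordinates_mfderiv {φ : M → N} {x : M}
    (hφ : ContMDiffAt I I' ∞ φ x) :
    MDifferentiableAt I 𝓘(ℝ, E →L[ℝ] E') (fun m ↦
      ContinuousLinearMap.inCoordinates E (TangentSpace I : M → Type _)
        E' (TangentSpace I' : N → Type _) (id x) (id m) (φ x) (φ m) (mfderiv I I' φ m)) x :=
  (hφ.mfderiv_const (m := 1) (by norm_cast)).mdifferentiableAt one_ne_zero

omit [FiniteDimensional ℝ E] [RiemannianBundle fun x : M ↦ TangentSpace I x]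
  [IsContMDiffRiemannianBundle I ∞ E fun x : M ↦ TangentSpace I x] [FiniteDimensional ℝ E']
  [RiemannianBundle fun y : N ↦ TangentSpace I' y]
  [IsContMDiffRiemannianBundle I' ∞ E' fun y : N ↦ TangentSpace I' y] in
theorem mdifferentiableAt_mfderiv_apply {φ : M → N} {x : M} (hφ : ContMDiffAt I I' ∞ φ x)
    {Z : Π y : M, TangentSpace I y} (hZ : MDiffAt (T% Z) x) :
    MDifferentiableAt I (I'.prod 𝓘(ℝ, E'))
      (fun y ↦ TotalSpace.mk' E' (E := (TangentSpace I' : N → Type _)) (φ y)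
        (mfderiv I I' φ y (Z y))) x :=
  (mdifferentiableAt_inCoordinates_mfderiv hφ).clm_apply_of_inCoordinates (b₁ := id) hZ
    (hφ.mdifferentiableAt (by simp))

theorem pullbackCovariantDerivative_mfderiv_sub {φ : M → N} {x : M}
    (hφ : ContMDiffAt I I' ∞ φ x) {Z : Π y : M, TangentSpace I y} (hZ : MDiffAt (T% Z) x)
    (v : TangentSpace I x) :
    pullbackCovariantDerivative I I' (leviCivita I' N) φ (fun y ↦ mfderiv I I' φ y (Z y)) x v
      - mfderiv I I' φ x (leviCivita I M Z x v) = mapSecondFundamentalForm I I' φ x v (Z x) := by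
  have hE := FiberBundle.mdifferentiableAt_extend I E (Z x)
  have h := pullbackCovariantDerivative_clm_apply_sub (leviCivita I M) (leviCivita I' N)
    (b := id) (mdifferentiableAt_inCoordinates_mfderiv hφ) hZ hE hφ.continuousAt (by simp) v
  have hid : ∀ {s : Π y : M, TangentSpace I y}, MDiffAt (T% s) x →
      pullbackCovariantDerivative I I (leviCivita I M) id s x v = leviCivita I M s x v := by
    intro s hs
    have := pullbackCovariantDerivative_comp (leviCivita I M) (φ := id) mdifferentiableAt_id hs v
    simpa using this
  rw [hid hZ, hid hE, map_sub] at h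
  rw [mapSecondFundamentalForm, sub_eq_sub_iff_sub_eq_sub]
  exact h

omit [FiniteDimensional ℝ E] [IsManifold I ∞ M] [RiemannianBundle fun x : M ↦ TangentSpace I x]
  [IsContMDiffRiemannianBundle I ∞ E fun x : M ↦ TangentSpace I x] [FiniteDimensional ℝ E']
  [IsContMDiffRiemannianBundle I' ∞ E' fun y : N ↦ TangentSpace I' y] in
theorem IsAlmostHermitian.mdifferentiableAt_inCoordinates
    {J : Π y : N, TangentSpace I' y →L[ℝ] TangentSpace I' y} (hJ : IsAlmostHermitian I' J)
    {φ : M → N} {x : M} (hφ : MDifferentiableAt I I' φ x) :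
    MDifferentiableAt I 𝓘(ℝ, E' →L[ℝ] E') (fun m ↦
      ContinuousLinearMap.inCoordinates E' (TangentSpace I' : N → Type _)
        E' (TangentSpace I' : N → Type _) (φ x) (φ m) (φ x) (φ m) (J (φ m))) x := by
  have h := ((mdifferentiableAt_hom_bundle _).1
    ((hJ.contMDiff (φ x)).mdifferentiableAt (by simp))).2
  exact h.comp x hφ

omit [FiniteDimensional ℝ E] [IsManifold I ∞ M] [RiemannianBundle fun x : M ↦ TangentSpace I x]
  [IsContMDiffRiemannianBundle I ∞ E fun x : M ↦ TangentSpace I x] [FiniteDimensional ℝ E']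
  [IsContMDiffRiemannianBundle I' ∞ E' fun y : N ↦ TangentSpace I' y] in
theorem IsAlmostHermitian.mdifferentiableAt_apply
    {J : Π y : N, TangentSpace I' y →L[ℝ] TangentSpace I' y} (hJ : IsAlmostHermitian I' J)
    {φ : M → N} {x : M} {σ : Π y : M, TangentSpace I' (φ y)}
    (hσ : MDifferentiableAt I (I'.prod 𝓘(ℝ, E')) (fun y ↦ TotalSpace.mk' E' (φ y) (σ y)) x) :
    MDifferentiableAt I (I'.prod 𝓘(ℝ, E'))
      (fun y ↦ TotalSpace.mk' E' (φ y) (J (φ y) (σ y))) x := by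
  have hφ : MDifferentiableAt I I' φ x := ((mdifferentiableAt_totalSpace _ _).1 hσ).1
  exact (hJ.mdifferentiableAt_inCoordinates hφ).clm_apply_of_inCoordinates hσ hφ

omit [FiniteDimensional ℝ E'] [IsContMDiffRiemannianBundle I' ∞ E' fun y : N ↦ TangentSpace I' y] in
theorem IsAlmostHermitian.mdifferentiableAt_apply_section
    {J : Π y : N, TangentSpace I' y →L[ℝ] TangentSpace I' y} (hJ : IsAlmostHermitian I' J)
    {y : N} {τ : Π z : N, TangentSpace I' z} (hτ : MDiffAt (T% τ) y) :
    MDiffAt (T% (fun z ↦ J z (τ z))) y :=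
  hJ.mdifferentiableAt_apply (φ := id) hτ

omit [FiniteDimensional ℝ E] [IsManifold I ∞ M] [RiemannianBundle fun x : M ↦ TangentSpace I x]
  [IsContMDiffRiemannianBundle I ∞ E fun x : M ↦ TangentSpace I x] in
theorem pullbackCovariantDerivative_almostComplex
    {J : Π y : N, TangentSpace I' y →L[ℝ] TangentSpace I' y} (hJ : IsAlmostHermitian I' J)
    {φ : M → N} {x : M} {σ : Π y : M, TangentSpace I' (φ y)}
    (hσ : MDifferentiableAt I (I'.prod 𝓘(ℝ, E')) (fun y ↦ TotalSpace.mk' E' (φ y) (σ y)) x)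
    (v : TangentSpace I x) :
    pullbackCovariantDerivative I I' (leviCivita I' N) φ (fun y ↦ J (φ y) (σ y)) x v
      = nablaEnd I' J (φ x) (mfderiv I I' φ x v) (σ x)
        + J (φ x) (pullbackCovariantDerivative I I' (leviCivita I' N) φ σ x v) := by
  have hφ : MDifferentiableAt I I' φ x := ((mdifferentiableAt_totalSpace _ _).1 hσ).1
  have hE := FiberBundle.mdifferentiableAt_extend I' E' (σ x)
  have h := pullbackCovariantDerivative_clm_apply_sub (leviCivita I' N) (leviCivita I' N)
    (s' := fun y ↦ FiberBundle.extend E' (σ x) (φ y))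
    (hJ.mdifferentiableAt_inCoordinates hφ) hσ (hE.comp x hφ) hφ.continuousAt (by simp) v
  rw [pullbackCovariantDerivative_comp _ hφ (hJ.mdifferentiableAt_apply_section hE),
    pullbackCovariantDerivative_comp _ hφ hE, map_sub, sub_eq_sub_iff_sub_eq_sub] at h
  rw [nablaEnd, ← h]
  abel

theorem nablaEnd_tensorialAt
    {J : Π y : N, TangentSpace I' y →L[ℝ] TangentSpace I' y} (hJ : IsAlmostHermitian I' J)
    (y : N) (Z : TangentSpace I' y) :
    TensorialAt I' E' (fun τ : Π z : N, TangentSpace I' z ↦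
      leviCivita I' N (fun z ↦ J z (τ z)) y Z - J y (leviCivita I' N τ y Z)) y where
  smul {f τ} hf hτ := by
    have h1 := (leviCivita I' N).isCovariantDerivativeOnUniv.leibniz hτ hf
    have h2 := (leviCivita I' N).isCovariantDerivativeOnUniv.leibniz
      (hJ.mdifferentiableAt_apply_section hτ) hf
    simp only [Pi.smul_def', map_smul] at h1 h2 ⊢
    rw [h1, h2]
    simp [smul_sub]
  add {τ τ'} hτ hτ' := by
    have h1 := (leviCivita I' N).isCovariantDerivativeOnUniv.add hτ hτ'
    have h2 := (leviCivita I' N).isCovariantDerivativeOnUniv.add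
      (hJ.mdifferentiableAt_apply_section hτ) (hJ.mdifferentiableAt_apply_section hτ')
    simp only [Pi.add_def, map_add] at h1 h2 ⊢
    rw [h1, h2]
    simp
    abel

theorem isBilinearMap_nablaEnd
    {J : Π y : N, TangentSpace I' y →L[ℝ] TangentSpace I' y} (hJ : IsAlmostHermitian I' J)
    (y : N) : IsBilinearMap ℝ (nablaEnd I' J y) where
  add_left Z Z' W := by
    simp only [nablaEnd, map_add]
    abel
  smul_left c Z W := by simp [nablaEnd, smul_sub]
  add_right Z W W' := by
    have h := (TensorialAt.mkHom _ y (nablaEnd_tensorialAt hJ y Z)).map_add W W'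
    rwa [TensorialAt.mkHom_apply_eq_extend, TensorialAt.mkHom_apply_eq_extend,
      TensorialAt.mkHom_apply_eq_extend] at h
  smul_right c Z W := by
    have h := (TensorialAt.mkHom _ y (nablaEnd_tensorialAt hJ y Z)).map_smul c W
    rwa [TensorialAt.mkHom_apply_eq_extend, TensorialAt.mkHom_apply_eq_extend] at h

end Maps

section Symmetry

variable {E : Type*} [NormedAddCommGroup E] [NormedSpace ℝ E]
  {H : Type*} [TopologicalSpace H] {I : ModelWithCorners ℝ E H}
  {M : Type*} [TopologicalSpace M] [ChartedSpace H M] [IsManifold I ∞ M]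

/-- The components of a tangent vector in the chart at its own base point. -/
theorem trivializationAt_tangentSpace_self {x : M} (v : TangentSpace I x) :
    (trivializationAt E (TangentSpace I : M → Type _) x ⟨x, v⟩).2 = v := by
  have h := (trivializationAt E (TangentSpace I : M → Type _) x).continuousLinearMapAt_apply_of_mem
    (R := ℝ) (FiberBundle.mem_baseSet_trivializationAt' x) v
  rw [TangentBundle.continuousLinearMapAt_trivializationAt (mem_chart_source H x),
    mfderiv_extChartAt_self] at h
  exact h.symm

theorem mlieBracket_extend {x : M} (a b : TangentSpace I x) :
    VectorField.mlieBracket I (FiberBundle.extend E a) (FiberBundle.extend E b) x = 0 := by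
  have key : ∀ a : TangentSpace I x, ∃ w : E, ∀ᶠ y in 𝓝[Set.range I] (extChartAt I x x),
      VectorField.mpullbackWithin 𝓘(ℝ, E) I (extChartAt I x).symm (FiberBundle.extend E a)
        (Set.range I) y = w := by
    intro a
    refine ⟨(trivializationAt E (TangentSpace I : M → Type _) x ⟨x, a⟩).2, ?_⟩
    filter_upwards [extChartAt_target_mem_nhdsWithin (I := I) x] with y hy
    have hs : (extChartAt I x).symm y ∈ (chartAt H x).source := by
      simpa using (extChartAt I x).map_target hy
    have h1 := TangentBundle.symmL_trivializationAt (I := I) (𝕜 := ℝ) hs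
    rw [(extChartAt I x).right_inv hy] at h1
    have h2 : FiberBundle.extend E a ((extChartAt I x).symm y)
        = mfderivWithin 𝓘(ℝ, E) I (extChartAt I x).symm (Set.range I) y
          (trivializationAt E (TangentSpace I : M → Type _) x ⟨x, a⟩).2 := by
      refine Eq.trans ?_ (congrArg (fun L : E →L[ℝ] TangentSpace I ((extChartAt I x).symm y) ↦
        L (trivializationAt E (TangentSpace I : M → Type _) x ⟨x, a⟩).2) h1)
      exact (Trivialization.symmL_apply _ hs _).symm
    rw [VectorField.mpullbackWithin_apply, h2]
    exact ((isInvertible_mfderivWithin_extChartAt_symm hy).inverse_apply_eq).2 rfl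
  obtain ⟨wa, ha⟩ := key a
  obtain ⟨wb, hb⟩ := key b
  rw [VectorField.mlieBracket, VectorField.mlieBracketWithin_apply]
  have h : VectorField.lieBracketWithin ℝ
      (VectorField.mpullbackWithin 𝓘(ℝ, E) I (extChartAt I x).symm (FiberBundle.extend E a)
        (Set.range I))
      (VectorField.mpullbackWithin 𝓘(ℝ, E) I (extChartAt I x).symm (FiberBundle.extend E b)
        (Set.range I)) (Set.range I) (extChartAt I x x)
      = VectorField.lieBracketWithin ℝ (fun _ ↦ wa) (fun _ ↦ wb) (Set.range I)
        (extChartAt I x x) :=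
    Filter.EventuallyEq.lieBracketWithin_vectorField_eq_of_mem ha hb (by simp)
  rw [Set.preimage_univ, Set.univ_inter]
  erw [h]
  have h0 : VectorField.lieBracketWithin ℝ (fun _ ↦ wa) (fun _ ↦ wb) (Set.range I)
      (extChartAt I x x) = 0 := by simp [VectorField.lieBracketWithin]
  erw [h0]
  exact _root_.map_zero _

end Symmetry

section Symmetry

variable {E : Type*} [NormedAddCommGroup E] [NormedSpace ℝ E] [FiniteDimensional ℝ E]
  {M : Type*} [TopologicalSpace M] [ChartedSpace E M] [IsManifold 𝓘(ℝ, E) ∞ M]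
  {E' : Type*} [NormedAddCommGroup E'] [NormedSpace ℝ E'] [FiniteDimensional ℝ E']
  {N : Type*} [TopologicalSpace N] [ChartedSpace E' N] [IsManifold 𝓘(ℝ, E') ∞ N]

omit [FiniteDimensional ℝ E] [FiniteDimensional ℝ E'] [IsManifold 𝓘(ℝ, E) ∞ M]
  [IsManifold 𝓘(ℝ, E') ∞ N] in
theorem contDiffAt_writtenInExtChartAt {φ : M → N} {x : M}
    (hφ : ContMDiffAt 𝓘(ℝ, E) 𝓘(ℝ, E') ∞ φ x) :
    ContDiffAt ℝ ∞ (writtenInExtChartAt 𝓘(ℝ, E) 𝓘(ℝ, E') x φ) (extChartAt 𝓘(ℝ, E) x x) := by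
  have h := (contMDiffAt_iff.1 hφ).2
  rwa [modelWithCornersSelf_coe, Set.range_id, contDiffWithinAt_univ] at h

omit [FiniteDimensional ℝ E] [FiniteDimensional ℝ E'] in
theorem coordDeriv_mfderiv_extend {φ : M → N} (hφ : ContMDiff 𝓘(ℝ, E) 𝓘(ℝ, E') ∞ φ)
    {x : M} (v w : TangentSpace 𝓘(ℝ, E) x) :
    coordDeriv 𝓘(ℝ, E) E' φ (fun y ↦ (mfderiv 𝓘(ℝ, E) 𝓘(ℝ, E') φ y
        (FiberBundle.extend E w y) : TangentSpace 𝓘(ℝ, E') (φ y))) x v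
      = fderiv ℝ (fderiv ℝ (writtenInExtChartAt 𝓘(ℝ, E) 𝓘(ℝ, E') x φ))
        (extChartAt 𝓘(ℝ, E) x x) v w := by
  set f := writtenInExtChartAt 𝓘(ℝ, E) 𝓘(ℝ, E') x φ with hf
  have hfd : ContDiffAt ℝ ∞ f (extChartAt 𝓘(ℝ, E) x x) := contDiffAt_writtenInExtChartAt (hφ x)
  have hev : (fun y ↦ (trivializationAt E' (TangentSpace 𝓘(ℝ, E') : N → Type _) (φ x)
      ⟨φ y, mfderiv 𝓘(ℝ, E) 𝓘(ℝ, E') φ y (FiberBundle.extend E w y)⟩).2) =ᶠ[𝓝 x]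
      fun y ↦ fderiv ℝ f (extChartAt 𝓘(ℝ, E) x y) w := by
    filter_upwards [eventually_mem_baseSet (F := E) (V := (TangentSpace 𝓘(ℝ, E) : M → Type _))
        (continuousAt_id (x := x)),
      eventually_mem_baseSet (F := E') (V := (TangentSpace 𝓘(ℝ, E') : N → Type _))
        (hφ x).continuousAt] with y hy hy'
    rw [id, id] at hy
    have hys : y ∈ (extChartAt 𝓘(ℝ, E) x).source := by simpa using hy
    obtain ⟨p, hp, rfl⟩ : ∃ p ∈ (extChartAt 𝓘(ℝ, E) x).target, (extChartAt 𝓘(ℝ, E) x).symm p = y :=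
      ⟨_, (extChartAt 𝓘(ℝ, E) x).map_source hys, (extChartAt 𝓘(ℝ, E) x).left_inv hys⟩
    have h1 : HasMFDerivAt 𝓘(ℝ, E) 𝓘(ℝ, E) (extChartAt 𝓘(ℝ, E) x).symm p
        ((trivializationAt E (TangentSpace 𝓘(ℝ, E) : M → Type _) x).symmL ℝ
          ((extChartAt 𝓘(ℝ, E) x).symm p)) := by
      have h := (mdifferentiableWithinAt_extChartAt_symm hp).hasMFDerivWithinAt
      have h' := TangentBundle.symmL_trivializationAt (𝕜 := ℝ) (I := 𝓘(ℝ, E)) hy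
      rw [(extChartAt 𝓘(ℝ, E) x).right_inv hp] at h'
      rw [h']
      rw [modelWithCornersSelf_coe, Set.range_id] at h ⊢
      rwa [hasMFDerivWithinAt_univ] at h
    have h2 : HasMFDerivAt 𝓘(ℝ, E) 𝓘(ℝ, E') φ ((extChartAt 𝓘(ℝ, E) x).symm p)
        (mfderiv 𝓘(ℝ, E) 𝓘(ℝ, E') φ ((extChartAt 𝓘(ℝ, E) x).symm p)) :=
      ((hφ _).mdifferentiableAt (by simp)).hasMFDerivAt
    have h3 : HasMFDerivAt 𝓘(ℝ, E') 𝓘(ℝ, E') (extChartAt 𝓘(ℝ, E') (φ x))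
        (φ ((extChartAt 𝓘(ℝ, E) x).symm p))
        ((trivializationAt E' (TangentSpace 𝓘(ℝ, E') : N → Type _) (φ x)).continuousLinearMapAt
          ℝ (φ ((extChartAt 𝓘(ℝ, E) x).symm p))) := by
      rw [TangentBundle.continuousLinearMapAt_trivializationAt hy']
      exact (mdifferentiableAt_extChartAt hy').hasMFDerivAt
    let L : E →L[ℝ] E' :=
      ((trivializationAt E' (TangentSpace 𝓘(ℝ, E') : N → Type _) (φ x)).continuousLinearMapAt
          ℝ (φ ((extChartAt 𝓘(ℝ, E) x).symm p))).comp
        ((mfderiv 𝓘(ℝ, E) 𝓘(ℝ, E') φ ((extChartAt 𝓘(ℝ, E) x).symm p)).comp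
          ((trivializationAt E (TangentSpace 𝓘(ℝ, E) : M → Type _) x).symmL ℝ
            ((extChartAt 𝓘(ℝ, E) x).symm p)))
    have h4 : HasFDerivAt f L p := hasMFDerivAt_iff_hasFDerivAt.1 (h3.comp p (h2.comp p h1))
    rw [(extChartAt 𝓘(ℝ, E) x).right_inv hp, h4.fderiv]
    have h5 : FiberBundle.extend E w ((extChartAt 𝓘(ℝ, E) x).symm p)
        = (trivializationAt E (TangentSpace 𝓘(ℝ, E) : M → Type _) x).symmL ℝ
            ((extChartAt 𝓘(ℝ, E) x).symm p) w := by
      refine Eq.trans (Trivialization.symmL_apply _ hy _).symm (congrArg _ ?_)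
      exact trivializationAt_tangentSpace_self w
    rw [h5, ← Trivialization.continuousLinearMapAt_apply_of_mem (R := ℝ) _ hy']
    rfl
  rw [coordDeriv, mvfderiv_congr_of_eventuallyEq hev]
  have hg : DifferentiableAt ℝ (fderiv ℝ f) (extChartAt 𝓘(ℝ, E) x x) :=
    (hfd.fderiv_right (m := 1) (by norm_cast)).differentiableAt one_ne_zero
  have hg' : MDifferentiableAt 𝓘(ℝ, E) 𝓘(ℝ, E') (fun z ↦ fderiv ℝ f z w)
      (extChartAt 𝓘(ℝ, E) x x) :=
    (hg.clm_apply (differentiableAt_const w)).mdifferentiableAt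
  have h := mfderiv_comp_apply x hg' (mdifferentiableAt_extChartAt (mem_chart_source E x)) v
  rw [mfderiv_extChartAt_self, mfderiv_eq_fderiv] at h
  refine h.trans ?_
  have h' : ∀ v u : E, fderiv ℝ (fun z ↦ fderiv ℝ f z u) (extChartAt 𝓘(ℝ, E) x x) v
      = fderiv ℝ (fderiv ℝ f) (extChartAt 𝓘(ℝ, E) x x) v u := by
    intro v u
    rw [fderiv_clm_apply hg (differentiableAt_const u)]
    simp
  exact h' v w

end Symmetry

section Symmetry

variable {E : Type*} [NormedAddCommGroup E] [NormedSpace ℝ E] [FiniteDimensional ℝ E]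
  {M : Type*} [TopologicalSpace M] [ChartedSpace E M] [IsManifold 𝓘(ℝ, E) ∞ M]
  [RiemannianBundle (fun x : M ↦ TangentSpace 𝓘(ℝ, E) x)]
  [IsContMDiffRiemannianBundle 𝓘(ℝ, E) ∞ E (fun x : M ↦ TangentSpace 𝓘(ℝ, E) x)]
  {E' : Type*} [NormedAddCommGroup E'] [NormedSpace ℝ E'] [FiniteDimensional ℝ E']
  {N : Type*} [TopologicalSpace N] [ChartedSpace E' N] [IsManifold 𝓘(ℝ, E') ∞ N]
  [RiemannianBundle (fun y : N ↦ TangentSpace 𝓘(ℝ, E') y)]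
  [IsContMDiffRiemannianBundle 𝓘(ℝ, E') ∞ E' (fun y : N ↦ TangentSpace 𝓘(ℝ, E') y)]

theorem leviCivita_extend_comm {x : M} (a b : TangentSpace 𝓘(ℝ, E) x) :
    leviCivita 𝓘(ℝ, E) M (FiberBundle.extend E a) x b
      = leviCivita 𝓘(ℝ, E) M (FiberBundle.extend E b) x a := by
  have h := (CovariantDerivative.torsion_eq_zero_iff _).1
    (leviCivita_torsion (I := 𝓘(ℝ, E)) (M := M))
    (FiberBundle.mdifferentiableAt_extend 𝓘(ℝ, E) E a)
    (FiberBundle.mdifferentiableAt_extend 𝓘(ℝ, E) E b)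
  rw [mlieBracket_extend, sub_eq_zero] at h
  simpa using h.symm

theorem mapSecondFundamentalForm_comm {φ : M → N} (hφ : ContMDiff 𝓘(ℝ, E) 𝓘(ℝ, E') ∞ φ)
    {x : M} (v w : TangentSpace 𝓘(ℝ, E) x) :
    mapSecondFundamentalForm 𝓘(ℝ, E) 𝓘(ℝ, E') φ x v w
      = mapSecondFundamentalForm 𝓘(ℝ, E) 𝓘(ℝ, E') φ x w v := by
  have hs := (contDiffAt_writtenInExtChartAt (hφ x)).isSymmSndFDerivAt (by simp; norm_cast)
  simp only [mapSecondFundamentalForm, pullbackCovariantDerivative_eq_coordDeriv_add,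
    coordDeriv_mfderiv_extend hφ, FiberBundle.extend_apply_self]
  rw [leviCivita_extend_comm v w, leviCivita_extend_comm (mfderiv 𝓘(ℝ, E) 𝓘(ℝ, E') φ x w)]
  congr 3
  exact hs v w

theorem isBilinearMap_mapSecondFundamentalForm {φ : M → N} (hφ : ContMDiff 𝓘(ℝ, E) 𝓘(ℝ, E') ∞ φ)
    (x : M) :
    IsBilinearMap ℝ (mapSecondFundamentalForm 𝓘(ℝ, E) 𝓘(ℝ, E') φ x) := by
  have hadd : ∀ u v w, mapSecondFundamentalForm 𝓘(ℝ, E) 𝓘(ℝ, E') φ x (u + v) w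
      = mapSecondFundamentalForm 𝓘(ℝ, E) 𝓘(ℝ, E') φ x u w
        + mapSecondFundamentalForm 𝓘(ℝ, E) 𝓘(ℝ, E') φ x v w := by
    intro u v w
    simp only [mapSecondFundamentalForm, pullbackCovariantDerivative_eq_coordDeriv_add, map_add]
    abel
  have hsmul : ∀ (c : ℝ) v w, mapSecondFundamentalForm 𝓘(ℝ, E) 𝓘(ℝ, E') φ x (c • v) w
      = c • mapSecondFundamentalForm 𝓘(ℝ, E) 𝓘(ℝ, E') φ x v w := by
    intro c v w
    simp only [mapSecondFundamentalForm, pullbackCovariantDerivative_eq_coordDeriv_add, map_smul,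
      smul_add, smul_sub]
  refine ⟨hadd, hsmul, fun u v w ↦ ?_, fun c v w ↦ ?_⟩
  · rw [mapSecondFundamentalForm_comm hφ, hadd, mapSecondFundamentalForm_comm hφ v,
      mapSecondFundamentalForm_comm hφ w]
  · rw [mapSecondFundamentalForm_comm hφ, hsmul, mapSecondFundamentalForm_comm hφ w]

end Symmetry

section SaddlePoint

variable {E E' : Type*} [NormedAddCommGroup E] [NormedSpace ℝ E]
  [NormedAddCommGroup E'] [NormedSpace ℝ E']

/-- The linear system for the horizontal lift `z` of a vector under `A`, with `l` a Lagrange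
multiplier: `(z, l) ↦ (g z - l ∘ A, A z)`. -/
def liftSystem (g : E →L[ℝ] E →L[ℝ] ℝ) (A : E →L[ℝ] E') :
    E × (E' →L[ℝ] ℝ) →L[ℝ] (E →L[ℝ] ℝ) × E' :=
  (g.comp (.fst ℝ E _) - (((ContinuousLinearMap.compL ℝ E E' ℝ).flip A).comp (.snd ℝ E _))).prod
    (A.comp (.fst ℝ E _))

theorem liftSystem_apply (g : E →L[ℝ] E →L[ℝ] ℝ) (A : E →L[ℝ] E') (z : E) (l : E' →L[ℝ] ℝ) :
    liftSystem g A (z, l) = (g z - l.comp A, A z) :=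
  rfl

variable [FiniteDimensional ℝ E] [FiniteDimensional ℝ E']

omit [FiniteDimensional ℝ E'] in
theorem finrank_continuousDual : Module.finrank ℝ (E →L[ℝ] ℝ) = Module.finrank ℝ E := by
  rw [← Subspace.dual_finrank_eq (K := ℝ) (V := E)]
  exact (LinearMap.toContinuousLinearMap (𝕜 := ℝ) (E := E) (F' := ℝ)).symm.finrank_eq

theorem isInvertible_liftSystem {g : E →L[ℝ] E →L[ℝ] ℝ} {A : E →L[ℝ] E'}
    (hg : ∀ z, g z z = 0 → z = 0) (hA : Function.Surjective A) :
    (liftSystem g A).IsInvertible := by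
  have hinj : Function.Injective (liftSystem g A).toLinearMap := by
    rw [← LinearMap.ker_eq_bot, LinearMap.ker_eq_bot']
    rintro ⟨z, l⟩ h
    have h' : (g z - l.comp A, A z) = 0 := h
    rw [Prod.mk_eq_zero, sub_eq_zero] at h'
    have hz : z = 0 := hg z (by rw [h'.1]; simp [h'.2])
    subst hz
    have hl : l = 0 := by
      ext u
      obtain ⟨w, rfl⟩ := hA u
      have := congrArg (fun f : E →L[ℝ] ℝ ↦ f w) h'.1
      simpa using this.symm
    rw [hl]
    rfl
  have hfin : Module.finrank ℝ (E × (E' →L[ℝ] ℝ)) = Module.finrank ℝ ((E →L[ℝ] ℝ) × E') := by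
    rw [Module.finrank_prod, Module.finrank_prod,
      finrank_continuousDual, finrank_continuousDual]
  exact ⟨(LinearEquiv.ofInjectiveOfFinrankEq _ hinj hfin).toContinuousLinearEquiv, by ext <;> rfl⟩

end SaddlePoint

section

variable {E : Type*} [NormedAddCommGroup E] [NormedSpace ℝ E]
  {H : Type*} [TopologicalSpace H] {I : ModelWithCorners ℝ E H}
  {M : Type*} [TopologicalSpace M] [ChartedSpace H M]
  {F G : Type*} [NormedAddCommGroup F] [NormedSpace ℝ F]
  [NormedAddCommGroup G] [NormedSpace ℝ G]

theorem mdifferentiableAt_of_clm_apply [FiniteDimensional ℝ F] {f : M → F →L[ℝ] G} {x : M}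
    (h : ∀ u, MDifferentiableAt I 𝓘(ℝ, G) (fun y ↦ f y u) x) :
    MDifferentiableAt I 𝓘(ℝ, F →L[ℝ] G) f x := by
  let b := Module.finBasis ℝ F
  let c := fun i ↦ LinearMap.toContinuousLinearMap (b.coord i)
  have hf : f = ∑ i, fun y ↦ ContinuousLinearMap.smulRightL ℝ F G (c i) (f y (b i)) := by
    ext y u
    have hu : f y u = ∑ i, b.repr u i • f y (b i) := by
      conv_lhs => rw [← b.sum_repr u]
      simp only [map_sum, map_smul]
    simp [c, hu]
  rw [hf]
  refine MDifferentiableAt.sum fun i _ ↦ ?_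
  exact (ContinuousLinearMap.smulRightL ℝ F G (c i)).mdifferentiableAt.comp x (h (b i))

theorem mdifferentiableAt_of_clm_apply_eq [CompleteSpace F] {f : M → F →L[ℝ] G} {s : M → F}
    {t : M → G} {x : M}
    (hf : MDifferentiableAt I 𝓘(ℝ, F →L[ℝ] G) f x) (hfx : (f x).IsInvertible)
    (ht : MDifferentiableAt I 𝓘(ℝ, G) t x) (h : ∀ᶠ y in 𝓝 x, f y (s y) = t y) :
    MDifferentiableAt I 𝓘(ℝ, F) s x := by
  obtain ⟨e, he⟩ := hfx
  have h1 : MDifferentiableAt I 𝓘(ℝ, G →L[ℝ] F) (fun y ↦ (f y).inverse) x := by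
    have h2 : DifferentiableAt ℝ ContinuousLinearMap.inverse (f x) := by
      rw [← he]
      exact (contDiffAt_map_inverse (n := 1) e).differentiableAt one_ne_zero
    exact h2.mdifferentiableAt.comp x hf
  refine (h1.clm_apply ht).congr_of_eventuallyEq ?_
  have h3 : ∀ᶠ y in 𝓝 x, f y ∈ Set.range ((↑) : (F ≃L[ℝ] G) → F →L[ℝ] G) :=
    hf.continuousAt.eventually (by rw [← he]; exact e.nhds)
  filter_upwards [h, h3] with y hy ⟨e', he'⟩
  rw [← hy, ← he']
  simp

end

section Horizontal

variable {E : Type*} [NormedAddCommGroup E] [NormedSpace ℝ E] [FiniteDimensional ℝ E]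
  {H : Type*} [TopologicalSpace H] {I : ModelWithCorners ℝ E H}
  {M : Type*} [TopologicalSpace M] [ChartedSpace H M] [IsManifold I ∞ M]
  [RiemannianBundle (fun x : M ↦ TangentSpace I x)]
  [IsContMDiffRiemannianBundle I ∞ E (fun x : M ↦ TangentSpace I x)]
  {E' : Type*} [NormedAddCommGroup E'] [NormedSpace ℝ E'] [FiniteDimensional ℝ E']
  {H' : Type*} [TopologicalSpace H'] {I' : ModelWithCorners ℝ E' H'}
  {N : Type*} [TopologicalSpace N] [ChartedSpace H' N] [IsManifold I' ∞ N]

variable (I) in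
/-- The metric in the trivialization of the tangent bundle around `x`. -/
def metricInCoordinates (x y : M) : E →L[ℝ] E →L[ℝ] ℝ :=
  LinearMap.toContinuousLinearMap (LinearMap.toContinuousLinearMap.toLinearMap ∘ₗ
    ((innerₗ (TangentSpace I y)).compl₁₂
      ((trivializationAt E (TangentSpace I : M → Type _) x).symmL ℝ y).toLinearMap
      ((trivializationAt E (TangentSpace I : M → Type _) x).symmL ℝ y).toLinearMap))

omit [IsContMDiffRiemannianBundle I ∞ E fun x : M ↦ TangentSpace I x] in
theorem metricInCoordinates_apply (x y : M) (u w : E) :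
    metricInCoordinates I x y u w
      = inner ℝ ((trivializationAt E (TangentSpace I : M → Type _) x).symmL ℝ y u)
        ((trivializationAt E (TangentSpace I : M → Type _) x).symmL ℝ y w) :=
  rfl

omit [FiniteDimensional ℝ E] [RiemannianBundle fun x : M ↦ TangentSpace I x]
  [IsContMDiffRiemannianBundle I ∞ E fun x : M ↦ TangentSpace I x] in
theorem mdifferentiableAt_symmL (x : M) (u : E) :
    MDiffAt (T% (fun y : M ↦
      (trivializationAt E (TangentSpace I : M → Type _) x).symmL ℝ y u)) x := by
  rw [mdifferentiableAt_section]
  refine (mdifferentiableAt_const (c := u)).congr_of_eventuallyEq ?_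
  filter_upwards [eventually_mem_baseSet (F := E) (V := (TangentSpace I : M → Type _))
    (continuousAt_id (x := x))] with y hy
  rw [id, id] at hy
  rw [← Trivialization.continuousLinearMapAt_apply_of_mem (R := ℝ) _ hy,
    Trivialization.continuousLinearMapAt_symmL _ hy]

theorem mdifferentiableAt_metricInCoordinates (x : M) :
    MDifferentiableAt I 𝓘(ℝ, E →L[ℝ] E →L[ℝ] ℝ) (metricInCoordinates I x) x := by
  refine mdifferentiableAt_of_clm_apply fun u ↦ mdifferentiableAt_of_clm_apply fun w ↦ ?_
  simp only [metricInCoordinates_apply]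
  exact mdifferentiableAt_inner (mdifferentiableAt_symmL x u) (mdifferentiableAt_symmL x w)

/-- A horizontal field whose image under the differential of a submersion is differentiable is
differentiable. -/
theorem mdifferentiableAt_of_horizontal {φ : M → N} (hφ : IsSmoothSubmersion I I' φ) {x : M}
    {Z : Π y : M, TangentSpace I y} (hZ : ∀ y, Z y ∈ horizontal I I' φ y)
    (hd : MDifferentiableAt I (I'.prod 𝓘(ℝ, E')) (fun y ↦ TotalSpace.mk' E'
      (E := (TangentSpace I' : N → Type _)) (φ y) (mfderiv I I' φ y (Z y))) x) :
    MDiffAt (T% Z) x := by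
  let e := trivializationAt E (TangentSpace I : M → Type _) x
  let e' := trivializationAt E' (TangentSpace I' : N → Type _) (φ x)
  let A : M → E →L[ℝ] E' := fun m ↦ ContinuousLinearMap.inCoordinates E
    (TangentSpace I : M → Type _) E' (TangentSpace I' : N → Type _) x m (φ x) (φ m)
    (mfderiv I I' φ m)
  have hAy : ∀ y w, A y w
      = e'.continuousLinearMapAt ℝ (φ y) (mfderiv I I' φ y (e.symmL ℝ y w)) := fun _ _ ↦ rfl
  have hA : MDifferentiableAt I 𝓘(ℝ, E →L[ℝ] E') A x :=
    mdifferentiableAt_inCoordinates_mfderiv (hφ.contMDiff x)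
  have hx := FiberBundle.mem_baseSet_trivializationAt' (F := E)
    (E := (TangentSpace I : M → Type _)) x
  have hx' := FiberBundle.mem_baseSet_trivializationAt' (F := E')
    (E := (TangentSpace I' : N → Type _)) (φ x)
  have hmul : ∀ y, ∃ l : E' →L[ℝ] ℝ, φ y ∈ e'.baseSet →
      ∀ w, inner ℝ (Z y) w = l (e'.continuousLinearMapAt ℝ (φ y) (mfderiv I I' φ y w)) := by
    intro y
    have h1 : innerₗ (TangentSpace I y) (Z y)
        ∈ (LinearMap.ker (mfderiv I I' φ y).toLinearMap).dualAnnihilator := by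
      rw [Submodule.mem_dualAnnihilator]
      intro w hw
      exact Submodule.inner_left_of_mem_orthogonal hw (hZ y)
    rw [← LinearMap.range_dualMap_eq_dualAnnihilator_ker] at h1
    obtain ⟨l, hl⟩ := h1
    refine ⟨LinearMap.toContinuousLinearMap (l ∘ₗ (e'.symmL ℝ (φ y)).toLinearMap),
      fun hy w ↦ ?_⟩
    have h2 := congrArg (fun f : Module.Dual ℝ (TangentSpace I y) ↦ f w) hl
    simp only [LinearMap.coe_toContinuousLinearMap', LinearMap.comp_apply,
      ContinuousLinearMap.coe_coe]
    rw [Trivialization.symmL_continuousLinearMapAt _ hy]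
    exact h2.symm
  choose l hl using hmul
  have hd' := ((mdifferentiableAt_totalSpace _ _).1 hd).2
  have hinv : (liftSystem (metricInCoordinates I x x) (A x)).IsInvertible := by
    refine isInvertible_liftSystem (fun z hz ↦ ?_) fun w ↦ ?_
    · rw [metricInCoordinates_apply, inner_self_eq_zero] at hz
      rw [← Trivialization.continuousLinearMapAt_symmL (R := ℝ) _ hx z]
      exact (congrArg _ hz).trans (_root_.map_zero _)
    · obtain ⟨u, hu⟩ := hφ.surjective x (e'.symmL ℝ (φ x) w)
      refine ⟨e.continuousLinearMapAt ℝ x u, ?_⟩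
      rw [hAy]
      rw [Trivialization.symmL_continuousLinearMapAt _ hx, hu,
        Trivialization.continuousLinearMapAt_symmL _ hx']
  have hT : MDifferentiableAt I 𝓘(ℝ, E × (E' →L[ℝ] ℝ) →L[ℝ] (E →L[ℝ] ℝ) × E')
      (fun y ↦ liftSystem (metricInCoordinates I x y) (A y)) x := by
    refine mdifferentiableAt_of_clm_apply fun ⟨z, l⟩ ↦ ?_
    simp only [liftSystem_apply]
    refine MDifferentiableAt.prodMk_space (.sub ?_ ?_) ?_
    · exact (mdifferentiableAt_metricInCoordinates x).clm_apply mdifferentiableAt_const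
    · exact (ContinuousLinearMap.compL ℝ E E' ℝ l).mdifferentiableAt.comp x hA
    · exact hA.clm_apply mdifferentiableAt_const
  rw [mdifferentiableAt_section]
  have h := mdifferentiableAt_of_clm_apply_eq (s := fun y ↦ ((e ⟨y, Z y⟩).2, l y)) hT hinv
    (t := fun y ↦ (0, (e' ⟨φ y, mfderiv I I' φ y (Z y)⟩).2))
    (mdifferentiableAt_const.prodMk_space hd') ?_
  · exact (ContinuousLinearMap.fst ℝ E (E' →L[ℝ] ℝ)).mdifferentiableAt.comp x h
  · filter_upwards [eventually_mem_baseSet (F := E) (V := (TangentSpace I : M → Type _))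
        (continuousAt_id (x := x)),
      eventually_mem_baseSet (F := E') (V := (TangentSpace I' : N → Type _))
        (hφ.contMDiff x).continuousAt] with y hy hy'
    rw [id, id] at hy
    have hZy : e.symmL ℝ y (e ⟨y, Z y⟩).2 = Z y := by
      rw [← Trivialization.continuousLinearMapAt_apply_of_mem (R := ℝ) _ hy,
        Trivialization.symmL_continuousLinearMapAt _ hy]
    rw [liftSystem_apply, Prod.mk.injEq, sub_eq_zero]
    refine ⟨?_, ?_⟩
    · ext w
      rw [metricInCoordinates_apply]
      refine Eq.trans (congrArg (fun u ↦ inner ℝ u (e.symmL ℝ y w)) hZy) ?_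
      rw [hl y hy']
      rfl
    · rw [hAy, hZy, Trivialization.continuousLinearMapAt_apply_of_mem (R := ℝ) _ hy']

end Horizontal

section MetricTrace

variable {V W : Type*} [NormedAddCommGroup V] [InnerProductSpace ℝ V] [FiniteDimensional ℝ V]
  [AddCommGroup W] [Module ℝ W]

omit [FiniteDimensional ℝ V] in
theorem sum_orthonormalBasis_eq {ι κ : Type*} [Fintype ι] [Fintype κ] {S : V → V → W}
    (hS : IsBilinearMap ℝ S) (b : OrthonormalBasis ι ℝ V) (c : OrthonormalBasis κ ℝ V) :
    ∑ i, S (b i) (b i) = ∑ j, S (c j) (c j) := by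
  classical
  have h : ∀ j, S (c j) (c j)
      = ∑ i, ∑ k, (inner ℝ (b i) (c j) * inner ℝ (c j) (b k)) • S (b i) (b k) := by
    intro j
    change hS.toLinearMap (c j) (c j) = _
    conv_lhs => rw [← b.sum_repr' (c j)]
    simp only [map_sum, LinearMap.sum_apply, map_smul, LinearMap.smul_apply,
      Finset.smul_sum, smul_smul]
    rw [Finset.sum_comm]
    refine Finset.sum_congr rfl fun i _ ↦ Finset.sum_congr rfl fun k _ ↦ ?_
    rw [real_inner_comm (c j) (b k), mul_comm]
    rfl
  simp only [h]
  rw [Finset.sum_comm]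
  refine Finset.sum_congr rfl fun i _ ↦ ?_
  rw [Finset.sum_comm]
  simp only [← Finset.sum_smul, c.sum_inner_mul_inner, OrthonormalBasis.inner_eq_ite]
  simp

theorem metricTrace_eq_sum {ι : Type*} [Fintype ι] {S : V → V → W}
    (hS : IsBilinearMap ℝ S) (b : OrthonormalBasis ι ℝ V) :
    metricTrace S = ∑ i, S (b i) (b i) :=
  sum_orthonormalBasis_eq hS _ b

theorem metricTrace_eq_add_orthogonal {S : V → V → W} (hS : IsBilinearMap ℝ S)
    (K : Submodule ℝ V) :
    metricTrace S = metricTrace (fun v w : K ↦ S v w) + metricTrace (fun v w : Kᗮ ↦ S v w) := by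
  rw [metricTrace_eq_sum hS (((stdOrthonormalBasis ℝ K).prod (stdOrthonormalBasis ℝ Kᗮ)).map
    K.orthogonalDecomposition.symm), Fintype.sum_sum_type]
  simp [metricTrace]

/-- The trace of `(v, w) ↦ S v (J w)` vanishes for `S` symmetric and `J` orthogonal with
`J² = -1`. -/
theorem metricTrace_comp_complexStructure_eq_zero {S : V → V → W} (hS : IsBilinearMap ℝ S)
    (hsymm : ∀ v w, S v w = S w v) {J : V →ₗ[ℝ] V} (hJ : ∀ v, J (J v) = -v)
    (hinner : ∀ v w, inner ℝ (J v) (J w) = inner ℝ v w) :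
    metricTrace (fun v w ↦ S v (J w)) = 0 := by
  have hSJ : IsBilinearMap ℝ (fun v w ↦ S v (J w)) :=
    ⟨fun u v w ↦ hS.add_left u v _, fun c v w ↦ hS.smul_left c v _,
      fun u v w ↦ by simp only [map_add, hS.add_right],
      fun c v w ↦ by simp only [map_smul, hS.smul_right]⟩
  let e : V ≃ₗᵢ[ℝ] V := (LinearEquiv.ofLinearMap J (-J) (by ext; simp [hJ])
    (by ext; simp [hJ])).isometryOfInner hinner
  have h := metricTrace_eq_sum hSJ ((stdOrthonormalBasis ℝ V).map e)
  have h2 : ∀ v, S (e v) (J (e v)) = -S v (J v) := by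
    intro v
    have hv : (J (e v)) = (-1 : ℝ) • v := by
      rw [neg_one_smul]
      exact hJ v
    rw [hv, hS.smul_right, neg_one_smul, hsymm]
    rfl
  simp only [OrthonormalBasis.map_apply, h2, Finset.sum_neg_distrib] at h
  have h3 : (2 : ℝ) • metricTrace (fun v w ↦ S v (J w)) = 0 := by
    rw [two_smul]
    nth_rewrite 1 [h]
    exact neg_add_cancel _
  exact (smul_eq_zero_iff_right two_ne_zero).1 h3

end MetricTrace

section Submersion

variable {E : Type*} [NormedAddCommGroup E] [NormedSpace ℝ E] [FiniteDimensional ℝ E]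
  {H : Type*} [TopologicalSpace H] {I : ModelWithCorners ℝ E H}
  {M : Type*} [TopologicalSpace M] [ChartedSpace H M] [IsManifold I ∞ M]
  [RiemannianBundle (fun x : M ↦ TangentSpace I x)]
  [IsContMDiffRiemannianBundle I ∞ E (fun x : M ↦ TangentSpace I x)]
  {E' : Type*} [NormedAddCommGroup E'] [NormedSpace ℝ E'] [FiniteDimensional ℝ E']
  {H' : Type*} [TopologicalSpace H'] {I' : ModelWithCorners ℝ E' H'}
  {N : Type*} [TopologicalSpace N] [ChartedSpace H' N] [IsManifold I' ∞ N]
  [RiemannianBundle (fun y : N ↦ TangentSpace I' y)]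
  [IsContMDiffRiemannianBundle I' ∞ E' (fun y : N ↦ TangentSpace I' y)]

omit [IsManifold I ∞ M] [IsContMDiffRiemannianBundle I ∞ E fun x : M ↦ TangentSpace I x]
  [FiniteDimensional ℝ E'] [IsManifold I' ∞ N]
  [IsContMDiffRiemannianBundle I' ∞ E' fun y : N ↦ TangentSpace I' y] in
theorem verticalProj_eq_sub (φ : M → N) (x : M) (v : TangentSpace I x) :
    (verticalProj I I' φ x v : TangentSpace I x) = v - horizontalProj I I' φ x v := by
  rw [eq_sub_iff_add_eq]
  exact Submodule.starProjection_add_starProjection_orthogonal (K := vertical I I' φ x) v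

omit [IsManifold I ∞ M] [IsContMDiffRiemannianBundle I ∞ E fun x : M ↦ TangentSpace I x]
  [FiniteDimensional ℝ E'] [IsManifold I' ∞ N]
  [IsContMDiffRiemannianBundle I' ∞ E' fun y : N ↦ TangentSpace I' y] in
theorem mfderiv_verticalProj (φ : M → N) (x : M) (v : TangentSpace I x) :
    mfderiv I I' φ x (verticalProj I I' φ x v : TangentSpace I x) = 0 :=
  LinearMap.mem_ker.1 (verticalProj I I' φ x v).2

omit [IsManifold I ∞ M] [IsContMDiffRiemannianBundle I ∞ E fun x : M ↦ TangentSpace I x]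
  [FiniteDimensional ℝ E'] [IsManifold I' ∞ N]
  [IsContMDiffRiemannianBundle I' ∞ E' fun y : N ↦ TangentSpace I' y] in
theorem mfderiv_horizontalProj (φ : M → N) (x : M) (v : TangentSpace I x) :
    mfderiv I I' φ x (horizontalProj I I' φ x v : TangentSpace I x) = mfderiv I I' φ x v := by
  have h := mfderiv_verticalProj (I := I) (I' := I') φ x v
  rw [verticalProj_eq_sub, map_sub, sub_eq_zero] at h
  exact h.symm

omit [IsContMDiffRiemannianBundle I' ∞ E' fun y : N ↦ TangentSpace I' y] in
theorem mdifferentiableAt_horizontalProj {φ : M → N} (hφ : IsSmoothSubmersion I I' φ) {x : M}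
    {Z : Π y : M, TangentSpace I y} (hZ : MDiffAt (T% Z) x) :
    MDiffAt (T% (fun y ↦ (horizontalProj I I' φ y (Z y) : TangentSpace I y))) x := by
  refine mdifferentiableAt_of_horizontal hφ (fun y ↦ (horizontalProj I I' φ y (Z y)).2) ?_
  simp only [mfderiv_horizontalProj]
  exact mdifferentiableAt_mfderiv_apply (hφ.contMDiff x) hZ

omit [IsContMDiffRiemannianBundle I' ∞ E' fun y : N ↦ TangentSpace I' y] in
theorem mdifferentiableAt_verticalProj {φ : M → N} (hφ : IsSmoothSubmersion I I' φ) {x : M}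
    {Z : Π y : M, TangentSpace I y} (hZ : MDiffAt (T% Z) x) :
    MDiffAt (T% (fun y ↦ (verticalProj I I' φ y (Z y) : TangentSpace I y))) x := by
  simp only [verticalProj_eq_sub]
  exact mdifferentiableAt_sub_section hZ (mdifferentiableAt_horizontalProj hφ hZ)

/-- On vertical vectors, the second fundamental form of a submersion is minus the second
fundamental form of the fibres. -/
theorem mapSecondFundamentalForm_vertical {φ : M → N} (hφ : IsSmoothSubmersion I I' φ) (x : M)
    (v w : vertical I I' φ x) :
    mapSecondFundamentalForm I I' φ x v w
      = -mfderiv I I' φ x (verticalSecondFundamentalForm I I' φ x v w : TangentSpace I x) := by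
  have hE := FiberBundle.mdifferentiableAt_extend I E (w : TangentSpace I x)
  have h := pullbackCovariantDerivative_mfderiv_sub (hφ.contMDiff x)
    (mdifferentiableAt_verticalProj hφ hE) (v : TangentSpace I x)
  have hw : (verticalProj I I' φ x (FiberBundle.extend E (w : TangentSpace I x) x) :
      TangentSpace I x) = w := by
    rw [FiberBundle.extend_apply_self]
    exact Submodule.starProjection_eq_self_iff.2 w.2
  have h0 : pullbackCovariantDerivative I I' (leviCivita I' N) φ (fun y ↦ mfderiv I I' φ y
      (verticalProj I I' φ y (FiberBundle.extend E (w : TangentSpace I x) y) :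
        TangentSpace I y)) x (v : TangentSpace I x) = 0 := by
    have hv : mfderiv I I' φ x (v : TangentSpace I x) = 0 := LinearMap.mem_ker.1 v.2
    rw [pullbackCovariantDerivative_eq_coordDeriv_add, hv, coordDeriv_of_eventually_const 0]
    · simp
    · filter_upwards [eventually_mem_baseSet (F := E') (V := (TangentSpace I' : N → Type _))
        (hφ.contMDiff x).continuousAt] with y hy
      rw [mfderiv_verticalProj]
      exact ((trivializationAt E' (TangentSpace I' : N → Type _) (φ x)).linear ℝ hy).map_zero
  rw [hw, h0, zero_sub] at h
  rw [← h, verticalSecondFundamentalForm, mfderiv_horizontalProj]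

/-- The derivative of the equation `φ_* ∘ J = J ∘ φ_*` on horizontal vectors. -/
theorem mapSecondFundamentalForm_horizontal
    {J : Π y : N, TangentSpace I' y →L[ℝ] TangentSpace I' y} (hJ : IsAlmostHermitian I' J)
    {φ : M → N} (hφ : IsSmoothSubmersion I I' φ)
    {JH : Π x : M, horizontal I I' φ x →ₗ[ℝ] horizontal I I' φ x}
    (hJH : IsHorizontallyHolomorphic I I' φ J JH) (x : M) (v w : horizontal I I' φ x) :
    mapSecondFundamentalForm I I' φ x v (JH x w : TangentSpace I x)
      = nablaEnd I' J (φ x) (mfderiv I I' φ x (v : TangentSpace I x))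
          (mfderiv I I' φ x (w : TangentSpace I x))
        + J (φ x) (mapSecondFundamentalForm I I' φ x v w)
        - mfderiv I I' φ x (horizontalNabla I I' φ JH x v w : TangentSpace I x) := by
  have hE := FiberBundle.mdifferentiableAt_extend I E (w : TangentSpace I x)
  have hW := mdifferentiableAt_horizontalProj hφ hE
  have hdW := mdifferentiableAt_mfderiv_apply (hφ.contMDiff x) hW
  have hJW : MDiffAt (T% (fun y ↦ (JH y (horizontalProj I I' φ y
      (FiberBundle.extend E (w : TangentSpace I x) y)) : TangentSpace I y))) x := by
    refine mdifferentiableAt_of_horizontal hφ (fun y ↦ (JH y _).2) ?_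
    simp only [hJH.map_eq]
    exact hJ.mdifferentiableAt_apply hdW
  have hw : horizontalProj I I' φ x (FiberBundle.extend E (w : TangentSpace I x) x) = w := by
    rw [FiberBundle.extend_apply_self]
    exact Submodule.orthogonalProjectionOnto_mem_subspace_eq_self w
  have h1 := pullbackCovariantDerivative_mfderiv_sub (hφ.contMDiff x) hW (v : TangentSpace I x)
  have h2 := pullbackCovariantDerivative_mfderiv_sub (hφ.contMDiff x) hJW (v : TangentSpace I x)
  simp only [hJH.map_eq] at h2
  rw [pullbackCovariantDerivative_almostComplex hJ hdW] at h2
  simp only [hw] at h1 h2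
  rw [← h1, ← h2, horizontalNabla, Submodule.coe_sub, map_sub, map_sub, mfderiv_horizontalProj,
    hJH.map_eq, mfderiv_horizontalProj]
  abel

end Submersion

end HorHol

end

theorem propositionA1
    {E : Type*} [NormedAddCommGroup E] [NormedSpace ℝ E] [FiniteDimensional ℝ E]
    {M : Type*} [TopologicalSpace M] [ChartedSpace E M] [IsManifold 𝓘(ℝ, E) ∞ M]
    [RiemannianBundle (fun x : M ↦ TangentSpace 𝓘(ℝ, E) x)]
    [IsContMDiffRiemannianBundle 𝓘(ℝ, E) ∞ E (fun x : M ↦ TangentSpace 𝓘(ℝ, E) x)]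
    {E' : Type*} [NormedAddCommGroup E'] [NormedSpace ℝ E'] [FiniteDimensional ℝ E']
    {N : Type*} [TopologicalSpace N] [ChartedSpace E' N] [IsManifold 𝓘(ℝ, E') ∞ N]
    [RiemannianBundle (fun y : N ↦ TangentSpace 𝓘(ℝ, E') y)]
    [IsContMDiffRiemannianBundle 𝓘(ℝ, E') ∞ E' (fun y : N ↦ TangentSpace 𝓘(ℝ, E') y)]
    (J : Π y : N, TangentSpace 𝓘(ℝ, E') y →L[ℝ] TangentSpace 𝓘(ℝ, E') y)
    (hJ : IsAlmostHermitian 𝓘(ℝ, E') J)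
    (φ : M → N) (hφ : IsSmoothSubmersion 𝓘(ℝ, E) 𝓘(ℝ, E') φ)
    (JH : Π x : M, horizontal 𝓘(ℝ, E) 𝓘(ℝ, E') φ x →ₗ[ℝ] horizontal 𝓘(ℝ, E) 𝓘(ℝ, E') φ x)
    (hJH : IsHorizontallyHolomorphic 𝓘(ℝ, E) 𝓘(ℝ, E') φ J JH) (x : M) :
    mfderiv 𝓘(ℝ, E) 𝓘(ℝ, E') φ x
        (JH x (metricTrace (verticalSecondFundamentalForm 𝓘(ℝ, E) 𝓘(ℝ, E') φ x)) :
          TangentSpace 𝓘(ℝ, E) x)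
      + J (φ x) (tensionField 𝓘(ℝ, E) 𝓘(ℝ, E') φ x)
      + tracePullbackNabla 𝓘(ℝ, E) 𝓘(ℝ, E') φ J x
      - mfderiv 𝓘(ℝ, E) 𝓘(ℝ, E') φ x
        (horizontalDivergence 𝓘(ℝ, E) 𝓘(ℝ, E') φ JH x : TangentSpace 𝓘(ℝ, E) x) = 0 := by
  have hS := isBilinearMap_mapSecondFundamentalForm hφ.contMDiff x
  have hn := isBilinearMap_nablaEnd hJ (φ x)
  have hT : IsBilinearMap ℝ (fun v w : TangentSpace 𝓘(ℝ, E) x ↦ nablaEnd 𝓘(ℝ, E') J (φ x)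
      (mfderiv 𝓘(ℝ, E) 𝓘(ℝ, E') φ x v) (mfderiv 𝓘(ℝ, E) 𝓘(ℝ, E') φ x w)) :=
    ⟨fun u v w ↦ by simp only [map_add, hn.add_left],
      fun c v w ↦ by simp only [map_smul, hn.smul_left],
      fun u v w ↦ by simp only [map_add, hn.add_right],
      fun c v w ↦ by simp only [map_smul, hn.smul_right]⟩
  have hSH : IsBilinearMap ℝ (fun v w : horizontal 𝓘(ℝ, E) 𝓘(ℝ, E') φ x ↦
      mapSecondFundamentalForm 𝓘(ℝ, E) 𝓘(ℝ, E') φ x v w) :=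
    ⟨fun u v w ↦ hS.add_left u v w, fun c v w ↦ hS.smul_left c v w,
      fun u v w ↦ hS.add_right u v w, fun c v w ↦ hS.smul_right c v w⟩
  have h0 := metricTrace_comp_complexStructure_eq_zero hSH
    (fun v w ↦ mapSecondFundamentalForm_comm hφ.contMDiff _ _) (hJH.sq x) (hJH.inner_map x)
  have hV : ∀ v : vertical 𝓘(ℝ, E) 𝓘(ℝ, E') φ x,
      mfderiv 𝓘(ℝ, E) 𝓘(ℝ, E') φ x (v : TangentSpace 𝓘(ℝ, E) x) = 0 :=
    fun v ↦ LinearMap.mem_ker.1 v.2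
  have hn0 : nablaEnd 𝓘(ℝ, E') J (φ x) 0 0 = 0 := by simp [nablaEnd]
  rw [hJH.map_eq, tensionField, tracePullbackNabla,
    metricTrace_eq_add_orthogonal hS (vertical 𝓘(ℝ, E) 𝓘(ℝ, E') φ x),
    metricTrace_eq_add_orthogonal hT (vertical 𝓘(ℝ, E) 𝓘(ℝ, E') φ x), horizontalDivergence]
  simp only [metricTrace, mapSecondFundamentalForm_horizontal hJ hφ hJH,
    Finset.sum_sub_distrib, Finset.sum_add_distrib] at h0
  simp only [metricTrace, mapSecondFundamentalForm_vertical hφ, hV, hn0, Submodule.coe_sum,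
    map_sum, map_add, map_neg, Finset.sum_neg_distrib, Finset.sum_const_zero, zero_add]
  rw [← h0]
  abel
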